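/- Fix an integer $n\ge 1$, a real $\varepsilon\in(0,1)$ and $\rho=0.000001$. For strings $u,v$ let $\mathrm{ed}(u,v)=|u|+|v|-2\,\mathrm{LCS}(u,v)$ be the indel distance. A permutation $\pi\in\mathcal S_n$ is identified with the string $\pi[1]\cdots\pi[n]$ (so $\mathrm{ed}$ is twice the Ulam distance on $\mathcal S_n$), and $\pi[s,e)$ is its substring at positions $s,\dots,e-1$. Let $P\subseteq\mathcal S_n$ be a finite set of permutations, let $x^*$ be an optimal 1-median of $P$, i.e. a minimizer over $\mathcal S_n$ of $x\mapsto\frac1{|P|}\sum_{p\in P}\mathrm{ed}(x,p)$, and let $\pi_1,\dots,\pi_5\in P$. Put $$\Delta(x^*)=\sum_{1\le i<j\le 5}\bigl(\mathrm{ed}(x^*,\pi_i)+\mathrm{ed}(x^*,\pi_j)-\mathrm{ed}(\pi_i,\pi_j)\bigr).$$ **The algorithm ScalableMedianReconstruct** (parameter $\varepsilon$, input $\pi_1,\dots,\pi_5$). Let $K=\lfloor n^{\varepsilon}\rfloor$, $\ell_j=\lfloor (j-1)n/K\rfloor+1$ and $B_j=\ell_{j+1}-\ell_j$ for $1\le j\le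 K$ (so $K=n^{\varepsilon}$ and $B_j=n^{1-\varepsilon}$ when these are integers). 1. *Windows.* A window is a pair of integers $(s,e)$ with $1\le s\le e\le n+1$. For each scale $N=(1+\rho)^k$, $0\le k\le\lceil\log_{1+\rho}(2n)\rceil$, the start positions for block $j$ are the integers $s\in[\ell_j-N,\ell_j+N]$ divisible by $\max(1,\lfloor\rho N n^{-\varepsilon}\rfloor)$. The end positions for such $s$ are $s+B_j$; $\lfloor s+B_j+(1+\rho)^a\rfloor$ for integers $0\le a\le\log_{1+\rho}\min(B_j/\rho,N)$; and $\lfloor s+B_j-(1+\rho)^a\rfloor$ for integers $0\le a\le\lceil\log_{1+\rho}(B_j-\rho B_j)\rceil$. Let $\mathcal W_j$ be the set of all windows obtained in this way over all scales, $\mathcal W^0_j$ the set of the windows $(s,s)$ with $s$ a start position for block $j$ at some scale, and $\mathcal W^0=\bigcup_j\mathcal W^0_j$. The groups for block $j$ are the elements of $\mathcal T_j=\mathcal W_j^5\cup\bigcup_{k=1}^5\bigl(\mathcal W_j^{k-1}\times\mathcal W^0\times\mathcal W_j^{5-k}\bigr)$. 2. *Block reconstruction.* For each $j$ and each group $((s_i,e_i))_{i=1}^5\in\mathcal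 T_j$ compute one candidate block as follows. Let $V$ be the set of elements occurring in at least four of the strings $\pi_i[s_i,e_i)$, and draw an edge $a\to b$ if $a$ precedes $b$ in strictly more of these strings than $b$ precedes $a$. While two distinct vertices have no edge between them, delete such a pair; then, while there is a directed triangle, delete the vertices of one. Let $\tau$ be a topological order of the remaining vertices; the candidate block is $\tau$, padded at its end with copies of a dummy symbol $\diamond$ to length $B_j$ if $|\tau|<B_j$. 3. *Block composition.* A valid sequence consists of $k\ge 1$ block indices $j_1<\dots<j_k$ in $\{1,\dots,K\}$ and groups $((s_{i,t},e_{i,t}))_{i=1}^5\in\mathcal T_{j_t}$ with $e_{i,t}\le s_{i,t+1}$ for all $i$ and $t<k$. It induces the string $Z=Z_1\cdots Z_K$, where $Z_{j_t}$ is the candidate block of the $t$-th group and every other $Z_h$ consists of $B_h$ copies of $\diamond$. Its cost is $$\sum_{i=1}^5\Bigl[\sum_{t=1}^k\mathrm{ed}\bigl(Z_{j_t},\pi_i[s_{i,t},e_{i,t})\bigr)+\sum_{h\notin\{j_1,\dots,j_k\}}B_h+(s_{i,1}-1)+\sum_{t=1}^{k-1}(s_{i,t+1}-e_{i,t})+(n+1-e_{i,k})\Bigr].$$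 Take the string $Z$ induced by a valid sequence of minimum cost. 4. *Postprocessing.* Delete the leftmost $|Z|-n$ symbols $\diamond$ from $Z$, then replace the remaining symbols $\diamond$, from left to right, by the elements of $[n]$ that do not occur, in increasing order. The resulting string $y$ is the output. **Lemma.** The algorithm has an output, and whatever arbitrary choices it makes (deleted pairs and triangles, optimal sequence), its output $y$ is a permutation of $[n]$ with $$\mathrm{ed}(y,x^*)\le 0.0009\sum_{i=1}^5\mathrm{ed}(x^*,\pi_i)+266\,\Delta(x^*).$$ -/

import Mathlib

namespace UlamMedian

/-! ### Indel distance, slack and medians -/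

/-- Length of a longest common subsequence of two strings. -/
def lcs {α : Type*} [DecidableEq α] (u v : List α) : ℕ :=
  (u.sublists.toFinset.filter (fun w => w.Sublist v)).sup List.length

theorem two_mul_lcs_le {α : Type*} [DecidableEq α] (u v : List α) :
    2 * lcs u v ≤ u.length + v.length := by
  have h1 : lcs u v ≤ u.length := Finset.sup_le fun w hw => by
    simp only [Finset.mem_filter, List.mem_toFinset, List.mem_sublists] at hw
    exact hw.1.length_le
  have h2 : lcs u v ≤ v.length := Finset.sup_le fun w hw => by
    simp only [Finset.mem_filter] at hw
    exact hw.2.length_le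
  omega

/-- Indel (LCS) distance: the least number of single-character insertions and deletions turning
`u` into `v`. The subtraction never truncates, by `two_mul_lcs_le`. -/
def ed {α : Type*} [DecidableEq α] (u v : List α) : ℕ :=
  u.length + v.length - 2 * lcs u v

/-- The string `p[1] p[2] … p[n]` of a permutation. -/
def str {n : ℕ} (p : Equiv.Perm (Fin n)) : List (Fin n) := List.ofFn p

/-- The average indel distance from `x` to the permutations in `P`. -/
noncomputable def cost {n : ℕ} (P : Finset (Equiv.Perm (Fin n))) (x : Equiv.Perm (Fin n)) : ℝ :=
  (1 / (P.card : ℝ)) * ∑ p ∈ P, (ed (str x) (str p) : ℝ)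

/-- `x` is an optimal 1-median of `P` (over all permutations). -/
def IsMedian {n : ℕ} (P : Finset (Equiv.Perm (Fin n))) (x : Equiv.Perm (Fin n)) : Prop :=
  ∀ z : Equiv.Perm (Fin n), cost P x ≤ cost P z

/-- Triangle inequality slack of `x` with respect to a pair of permutations. -/
noncomputable def slack {n : ℕ} (x p q : Equiv.Perm (Fin n)) : ℝ :=
  (ed (str x) (str p) : ℝ) + (ed (str x) (str q) : ℝ) - (ed (str p) (str q) : ℝ)

/-- Total slack of `x`: the sum of the slacks over all pairs `i < j`. -/
noncomputable def totalSlack {n : ℕ} (π : Fin 5 → Equiv.Perm (Fin n))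
    (x : Equiv.Perm (Fin n)) : ℝ :=
  ∑ i : Fin 5, ∑ j ∈ Finset.Ioi i, slack x (π i) (π j)

/-! ### Blocks

Positions are `1, …, n` and an interval `[s, e)` satisfies `1 ≤ s ≤ e ≤ n + 1`.
Blocks are numbered `0, …, K - 1`. -/

/-- The constant `ρ` of the algorithm. -/
noncomputable def rho : ℝ := 0.000001

/-- The number `n ^ ε` of blocks, rounded down. -/
noncomputable def numBlocks (n : ℕ) (ε : ℝ) : ℕ := ⌊(n : ℝ) ^ ε⌋₊

/-- First position of block `j` when the positions are cut into `K` contiguous blocks of equal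
length, up to rounding. -/
def blockStart (n K j : ℕ) : ℕ := j * n / K + 1

/-- Length of block `j`; it is `n / K` for every block if `K` divides `n`. -/
def blockSize (n K j : ℕ) : ℕ := blockStart n K (j + 1) - blockStart n K j

/-! ### Windows decomposition -/

/-- The spacing `ρ n ^ (μ - ε)` of start positions at the scale `n ^ μ = (1 + ρ) ^ k`, rounded
down to an integer, and at least `1`. -/
noncomputable def gap (n : ℕ) (ε : ℝ) (k : ℕ) : ℕ :=
  max 1 ⌊rho * (1 + rho) ^ k * (n : ℝ) ^ (-ε)⌋₊

/-- The scales `(1 + ρ) ^ k` with `0 ≤ k ≤ ⌈log_{1 + ρ} (2 n)⌉`. -/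
def IsScale (n k : ℕ) : Prop := (k : ℤ) ≤ ⌈Real.logb (1 + rho) (2 * n)⌉

/-- `s` is a start position for block `j` at scale `(1 + ρ) ^ k`. -/
def IsStart (n : ℕ) (ε : ℝ) (j k s : ℕ) : Prop :=
  (blockStart n (numBlocks n ε) j : ℝ) - (1 + rho) ^ k ≤ s ∧
  (s : ℝ) ≤ (blockStart n (numBlocks n ε) j : ℝ) + (1 + rho) ^ k ∧
  gap n ε k ∣ s

/-- `e` is an end position, belonging to the start position `s`, for a block of length `B` at
scale `(1 + ρ) ^ k`. End positions are rounded down to integers. -/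
def IsEnd (B k s e : ℕ) : Prop :=
  e = s + B ∨
  (∃ a : ℕ, (a : ℝ) ≤ Real.logb (1 + rho) (min ((B : ℝ) / rho) ((1 + rho) ^ k)) ∧
    (e : ℤ) = ⌊(s : ℝ) + B + (1 + rho) ^ a⌋) ∨
  (∃ a : ℕ, (a : ℤ) ≤ ⌈Real.logb (1 + rho) ((B : ℝ) - rho * B)⌉ ∧
    (e : ℤ) = ⌊(s : ℝ) + B - (1 + rho) ^ a⌋)

/-- The windows of block `j`. -/
def windows (n : ℕ) (ε : ℝ) (j : ℕ) : Set (ℕ × ℕ) :=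
  {w | 1 ≤ w.1 ∧ w.1 ≤ w.2 ∧ w.2 ≤ n + 1 ∧
    ∃ k, IsScale n k ∧ IsStart n ε j k w.1 ∧ IsEnd (blockSize n (numBlocks n ε) j) k w.1 w.2}

/-- The degenerate windows `[s, s)` of block `j`. -/
def emptyWindows (n : ℕ) (ε : ℝ) (j : ℕ) : Set (ℕ × ℕ) :=
  {w | 1 ≤ w.1 ∧ w.1 = w.2 ∧ w.2 ≤ n + 1 ∧ ∃ k, IsScale n k ∧ IsStart n ε j k w.1}

/-- Five windows, one for each input permutation. -/
abbrev Group := Fin 5 → ℕ × ℕ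

/-- The groups of windows for block `j`: five windows of block `j`, where at most one of them may
be replaced by a degenerate window of any block. -/
def groups (n : ℕ) (ε : ℝ) (j : ℕ) : Set Group :=
  {w | (∀ i, w i ∈ windows n ε j) ∨
    ∃ i₀, (∃ h < numBlocks n ε, w i₀ ∈ emptyWindows n ε h) ∧
      ∀ i, i ≠ i₀ → w i ∈ windows n ε j}

/-- The substring `p[s, e)`, with positions counted from `1`. -/
def substr {n : ℕ} (p : Equiv.Perm (Fin n)) (w : ℕ × ℕ) : List (Fin n) :=
  ((str p).drop (w.1 - 1)).take (w.2 - w.1)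

/-! ### Block reconstruction -/

/-- The elements that appear in at least four of the five strings. -/
def vertices {n : ℕ} (S : Fin 5 → List (Fin n)) : Finset (Fin n) :=
  Finset.univ.filter fun a => 4 ≤ (Finset.univ.filter fun i => a ∈ S i).card

/-- Number of strings in which `a` appears before `b`. -/
def countBefore {n : ℕ} (S : Fin 5 → List (Fin n)) (a b : Fin n) : ℕ :=
  (Finset.univ.filter fun i => [a, b].Sublist (S i)).card

/-- Edge relation of the majority graph. -/
def Edge {n : ℕ} (S : Fin 5 → List (Fin n)) (a b : Fin n) : Prop :=
  countBefore S b a < countBefore S a b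

/-- Removal of two distinct vertices with no edge between them. -/
def PairStep {n : ℕ} (S : Fin 5 → List (Fin n)) (V W : Finset (Fin n)) : Prop :=
  ∃ a ∈ V, ∃ b ∈ V, a ≠ b ∧ ¬ Edge S a b ∧ ¬ Edge S b a ∧ W = V \ {a, b}

/-- Removal of the vertices of a directed triangle. -/
def TriangleStep {n : ℕ} (S : Fin 5 → List (Fin n)) (V W : Finset (Fin n)) : Prop :=
  ∃ a ∈ V, ∃ b ∈ V, ∃ c ∈ V, Edge S a b ∧ Edge S b c ∧ Edge S c a ∧ W = V \ {a, b, c}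

/-- `W` is a possible result of a loop that starts in `V` and repeats `step` while possible. -/
def LoopResult {σ : Type*} (step : σ → σ → Prop) (V W : σ) : Prop :=
  Relation.ReflTransGen step V W ∧ ∀ U, ¬ step W U

/-- `t` is a topological ordering of the vertex set `V`. -/
def IsTopologicalSort {n : ℕ} (S : Fin 5 → List (Fin n)) (V : Finset (Fin n))
    (t : List (Fin n)) : Prop :=
  t.Nodup ∧ t.toFinset = V ∧ t.Pairwise fun a b => ¬ Edge S b a

/-- `z` is a possible result of the block reconstruction procedure on five strings, for a block of
length `B`. The dummy element is `none`; strings shorter than `B` are padded with it. -/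
def IsReconstruction {n : ℕ} (S : Fin 5 → List (Fin n)) (B : ℕ) (z : List (Option (Fin n))) :
    Prop :=
  ∃ V W t, LoopResult (PairStep S) (vertices S) V ∧ LoopResult (TriangleStep S) V W ∧
    IsTopologicalSort S W t ∧ z = t.map some ++ List.replicate (B - t.length) none

/-! ### Block composition

A choice of candidate blocks is a function `R`, where `R j w` is the candidate block computed for
the group `w` of block `j`. -/

/-- `R` consists of results of block reconstruction, one for every group of every block. -/
def IsCandidates {n : ℕ} (ε : ℝ) (π : Fin 5 → Equiv.Perm (Fin n))
    (R : ℕ → Group → List (Option (Fin n))) : Prop :=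
  ∀ j < numBlocks n ε, ∀ w ∈ groups n ε j,
    IsReconstruction (fun i => substr (π i) (w i)) (blockSize n (numBlocks n ε) j) (R j w)

/-- Valid sequences of pairs (block index, group): nonempty, with increasing block indices, and
such that every window ends no later than the next one, in the same permutation, starts. -/
def IsValid (n : ℕ) (ε : ℝ) (q : List (ℕ × Group)) : Prop :=
  q ≠ [] ∧ (∀ a ∈ q, a.1 < numBlocks n ε ∧ a.2 ∈ groups n ε a.1) ∧
    q.IsChain fun a b => a.1 < b.1 ∧ ∀ i, (a.2 i).2 ≤ (b.2 i).1

/-- Total length of the blocks `p, …, j - 1`. -/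
def blocksLength (n K p j : ℕ) : ℕ := ∑ h ∈ Finset.Ico p j, blockSize n K h

/-- The string of the blocks `p, …, K - 1` defined by a sequence: the selected blocks are filled
with their candidates and all other blocks with dummy elements. -/
def inducedFrom {n : ℕ} (K : ℕ) (R : ℕ → Group → List (Option (Fin n))) :
    ℕ → List (ℕ × Group) → List (Option (Fin n))
  | p, [] => List.replicate (blocksLength n K p K) none
  | p, (j, w) :: q =>
      List.replicate (blocksLength n K p j) none ++ R j w ++ inducedFrom K R (j + 1) q

/-- Cost of aligning the blocks `p, …, K - 1` with the suffixes `π i [pos i, n + 1)` as prescribed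
by a sequence: selected blocks are compared with their windows, while dummy blocks and the
positions outside of the windows are paid for in full. -/
def alignCostFrom {n : ℕ} (K : ℕ) (π : Fin 5 → Equiv.Perm (Fin n))
    (R : ℕ → Group → List (Option (Fin n))) : ℕ → (Fin 5 → ℕ) → List (ℕ × Group) → ℕ
  | p, pos, [] => ∑ i, (blocksLength n K p K + (n + 1 - pos i))
  | p, pos, (j, w) :: q =>
      ∑ i, (blocksLength n K p j + ((w i).1 - pos i)) +
      ∑ i, ed (R j w) ((substr (π i) (w i)).map some) +
      alignCostFrom K π R (j + 1) (fun i => (w i).2) q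

/-- The intermediate string induced by a sequence. -/
noncomputable def induced {n : ℕ} (ε : ℝ) (R : ℕ → Group → List (Option (Fin n)))
    (q : List (ℕ × Group)) : List (Option (Fin n)) :=
  inducedFrom (numBlocks n ε) R 0 q

/-- The objective function of the block composition step. -/
noncomputable def blockED {n : ℕ} (ε : ℝ) (π : Fin 5 → Equiv.Perm (Fin n))
    (R : ℕ → Group → List (Option (Fin n))) (q : List (ℕ × Group)) : ℕ :=
  alignCostFrom (numBlocks n ε) π R 0 (fun _ => 1) q

/-- A valid sequence of least objective value. -/
def IsOptimal {n : ℕ} (ε : ℝ) (π : Fin 5 → Equiv.Perm (Fin n))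
    (R : ℕ → Group → List (Option (Fin n))) (q : List (ℕ × Group)) : Prop :=
  IsValid n ε q ∧ ∀ r, IsValid n ε r → blockED ε π R q ≤ blockED ε π R r

/-! ### Postprocessing -/

/-- Remove the leftmost `m` dummy elements. -/
def dropDummies {α : Type*} : ℕ → List (Option α) → List (Option α)
  | 0, l => l
  | _ + 1, [] => []
  | m + 1, none :: l => dropDummies m l
  | m + 1, some a :: l => some a :: dropDummies (m + 1) l

/-- Replace the dummy elements, from left to right, by the elements of the second list. -/
def fillDummies {α : Type*} : List (Option α) → List α → List α
  | [], _ => []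
  | some a :: l, us => a :: fillDummies l us
  | none :: l, u :: us => u :: fillDummies l us
  | none :: l, [] => fillDummies l []

/-- The elements not occurring in a string, in increasing order. -/
def unused {n : ℕ} (z : List (Option (Fin n))) : List (Fin n) :=
  (Finset.univ.filter fun a => some a ∉ z).sort (· ≤ ·)

/-- Remove dummy elements from the left until the length is `n`, then replace the remaining ones
by the unused elements in increasing order. -/
def postProcess {n : ℕ} (z : List (Option (Fin n))) : List (Fin n) :=
  fillDummies (dropDummies (z.length - n) z) (unused (dropDummies (z.length - n) z))

/-- `out` is a possible output of the algorithm with parameter `ε` on the input `π`; the arbitrary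
choices made by the algorithm (vertices to be removed, optimal sequence) are left open. -/
def IsOutput {n : ℕ} (ε : ℝ) (π : Fin 5 → Equiv.Perm (Fin n)) (out : List (Fin n)) : Prop :=
  ∃ R q, IsCandidates ε π R ∧ IsOptimal ε π R q ∧ out = postProcess (induced ε R q)

end UlamMedian

/-! For permutations, `ed` is a set quantity: the symbols of a longest common subsequence of `x` and
`p` form a largest set `A` on which both have the same order, and `ed = 2n - 2|A|`
(`exists_agreeOn`, `AgreeOn.ed_le`). Fix such sets `A i` for `x = x*` and the five inputs. A symbol
missing from two of them is `unreliable`; since `A i ∩ A j` bounds the distance between two inputs,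
the number of unreliable symbols is at most half the total slack.

Stability (`ed_le_of_sum_ed_le`): two symbols that are reliable for both `x` and `y` share an input
in which all four matchings survive, because each excludes at most one of five. Hence `x` and `y`
agree off the unreliable symbols, and `ed y x` is at most the sum of the two total slacks. Total
slack is four times the total distance minus a quantity independent of `x`, so any `y` whose total
distance exceeds that of `x` by at most `α` is within `2Δ + 4α`.

The total distance of the output is at most the cost of its sequence (`exists_postProcess_induced`),
so by optimality one cheap valid sequence suffices. It comes from cutting `x` into blocks and
following each block through the alignments. Rounding to available windows loses an `O(ρ)` fraction
of the distances (`exists_windows`). Inside a block, reliable symbols form a transitive tournament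
ordered as in `x`, and every deletion step removes an unreliable vertex; so a candidate is as good
as the block of `x`, up to a constant per unreliable symbol (`IsReconstruction.ed_add_le`). Summing
gives `α = 15Δ + 224ρ ∑ ed` (`exists_isValid_blockED_le_sum_ed`). -/

namespace UlamMedian

/-! ### Common subsequences and indel distance -/

section Lists

variable {α : Type*} [DecidableEq α]

theorem length_le_lcs {u v w : List α} (hu : w.Sublist u) (hv : w.Sublist v) :
    w.length ≤ lcs u v := by
  unfold lcs
  exact Finset.le_sup (f := List.length) (by simp [hu, hv])

theorem exists_length_eq_lcs (u v : List α) :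
    ∃ w : List α, w.Sublist u ∧ w.Sublist v ∧ w.length = lcs u v := by
  unfold lcs
  obtain ⟨w, hw, h⟩ := Finset.exists_mem_eq_sup
    (u.sublists.toFinset.filter (fun w => w.Sublist v)) ⟨[], by simp⟩ List.length
  simp only [Finset.mem_filter, List.mem_toFinset, List.mem_sublists] at hw
  exact ⟨w, hw.1, hw.2, h.symm⟩

theorem ed_add_two_mul_length_le {u v w : List α} (hu : w.Sublist u) (hv : w.Sublist v) :
    ed u v + 2 * w.length ≤ u.length + v.length := by
  have h1 := length_le_lcs hu hv
  have h2 := two_mul_lcs_le u v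
  unfold ed
  omega

theorem exists_ed_add_two_mul_length_eq (u v : List α) :
    ∃ w : List α, w.Sublist u ∧ w.Sublist v ∧
      ed u v + 2 * w.length = u.length + v.length := by
  obtain ⟨w, hu, hv, h⟩ := exists_length_eq_lcs u v
  refine ⟨w, hu, hv, ?_⟩
  have h2 := two_mul_lcs_le u v
  unfold ed
  omega

theorem ed_le_length_add_length (u v : List α) : ed u v ≤ u.length + v.length := by
  unfold ed
  omega

theorem ed_append_le (u u' v v' : List α) :
    ed (u ++ u') (v ++ v') ≤ ed u v + ed u' v' := by
  obtain ⟨w, hu, hv, h⟩ := exists_ed_add_two_mul_length_eq u v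
  obtain ⟨w', hu', hv', h'⟩ := exists_ed_add_two_mul_length_eq u' v'
  have := ed_add_two_mul_length_le (hu.append hu') (hv.append hv')
  simp only [List.length_append] at this
  omega

end Lists

/-! ### Positions of symbols, substrings and sorted lists -/

variable {n : ℕ}

/-- The position, counted from `1`, of a symbol in a permutation. -/
def pos (p : Equiv.Perm (Fin n)) (a : Fin n) : ℕ := (p.symm a : ℕ) + 1

theorem pos_injective (p : Equiv.Perm (Fin n)) : Function.Injective (pos p) := fun a b h => by
  apply p.symm.injective
  unfold pos at h
  ext
  omega

theorem one_le_pos (p : Equiv.Perm (Fin n)) (a : Fin n) : 1 ≤ pos p a := Nat.le_add_left _ _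

theorem pos_lt (p : Equiv.Perm (Fin n)) (a : Fin n) : pos p a < n + 1 := by
  have := (p.symm a).isLt
  unfold pos
  omega

theorem card_pos_mem_Ico (p : Equiv.Perm (Fin n)) {s e : ℕ} (hs : 1 ≤ s) (he : e ≤ n + 1) :
    (Finset.univ.filter fun a => s ≤ pos p a ∧ pos p a < e).card = e - s := by
  rw [← Nat.card_Ico, ← Finset.card_image_of_injective _ (pos_injective p)]
  congr 1
  ext t
  simp only [Finset.mem_image, Finset.mem_filter, Finset.mem_univ, true_and, Finset.mem_Ico]
  constructor
  · rintro ⟨a, h, rfl⟩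
    exact h
  · intro h
    refine ⟨p ⟨t - 1, by omega⟩, ?_⟩
    have : pos p (p ⟨t - 1, by omega⟩) = t := by
      simp only [pos, Equiv.symm_apply_apply]
      omega
    rw [this]
    exact ⟨h, rfl⟩

@[simp] theorem length_str (p : Equiv.Perm (Fin n)) : (str p).length = n := by simp [str]

theorem pairwise_str (p : Equiv.Perm (Fin n)) :
    (str p).Pairwise fun a b => pos p a < pos p b := by
  unfold str
  rw [List.pairwise_ofFn]
  intro i j h
  simpa [pos] using h

theorem mem_str (p : Equiv.Perm (Fin n)) (a : Fin n) : a ∈ str p := by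
  simp only [str, List.mem_ofFn]
  exact ⟨p.symm a, by simp⟩

theorem nodup_of_pairwise_pos {p : Equiv.Perm (Fin n)} {l : List (Fin n)}
    (h : l.Pairwise fun a b => pos p a < pos p b) : l.Nodup :=
  h.imp fun hab e => by subst e; exact lt_irrefl _ hab

theorem exists_str_eq {l : List (Fin n)} (hl : l.Nodup) (hlen : l.length = n) :
    ∃ y : Equiv.Perm (Fin n), l = str y := by
  refine ⟨Equiv.ofBijective (fun i : Fin n => l.get (Fin.cast hlen.symm i)) ?_, ?_⟩
  · rw [← Finite.injective_iff_bijective]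
    exact (List.nodup_iff_injective_get.1 hl).comp (Fin.cast_injective _)
  · refine List.ext_getElem (by simp [hlen]) fun i h1 h2 => ?_
    simp [str]

/-- Both lists are sorted by the same injective position function, so inclusion of symbols is
enough. This reduces questions on subsequences to counting in sets. -/
theorem sublist_of_pairwise_pos {p : Equiv.Perm (Fin n)} {l S : List (Fin n)}
    (hl : l.Pairwise fun a b => pos p a < pos p b) (hS : S.Pairwise fun a b => pos p a < pos p b)
    (h : l ⊆ S) : l.Sublist S := by
  have : Std.Antisymm (fun a b : Fin n => pos p a ≤ pos p b) :=
    ⟨fun a b h1 h2 => pos_injective p (le_antisymm h1 h2)⟩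
  exact List.sublist_of_subperm_of_pairwise (r := fun a b => pos p a ≤ pos p b)
    (List.subperm_of_subset (nodup_of_pairwise_pos hl) h)
    (hl.imp fun h => le_of_lt h) (hS.imp fun h => le_of_lt h)

theorem pair_sublist_iff {p : Equiv.Perm (Fin n)} {S : List (Fin n)}
    (hS : S.Pairwise fun a b => pos p a < pos p b) {a b : Fin n} :
    [a, b].Sublist S ↔ a ∈ S ∧ b ∈ S ∧ pos p a < pos p b := by
  constructor
  · intro h
    have := hS.sublist h
    simp only [List.pairwise_cons, List.mem_singleton, forall_eq] at this
    exact ⟨h.subset (by simp), h.subset (by simp), this.1⟩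
  · rintro ⟨ha, hb, hab⟩
    refine sublist_of_pairwise_pos (p := p) (by simpa using hab) hS ?_
    intro c hc
    simp only [List.mem_cons, List.not_mem_nil, or_false] at hc
    rcases hc with rfl | rfl <;> assumption

theorem substr_sublist (p : Equiv.Perm (Fin n)) (w : ℕ × ℕ) : (substr p w).Sublist (str p) :=
  (List.take_sublist _ _).trans (List.drop_sublist _ _)

theorem pairwise_substr (p : Equiv.Perm (Fin n)) (w : ℕ × ℕ) :
    (substr p w).Pairwise fun a b => pos p a < pos p b :=
  (pairwise_str p).sublist (substr_sublist p w)

theorem mem_substr {p : Equiv.Perm (Fin n)} {w : ℕ × ℕ} (hw : 1 ≤ w.1) {a : Fin n} :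
    a ∈ substr p w ↔ w.1 ≤ pos p a ∧ pos p a < w.2 := by
  have ha := (p.symm a).isLt
  unfold substr
  rw [List.mem_take_iff_getElem]
  simp only [List.getElem_drop, List.length_drop, length_str]
  have key : ∀ (t : ℕ) (h : t < (str p).length), (str p)[t] = a ↔ t = (p.symm a : ℕ) := by
    intro t h
    simp only [str, List.getElem_ofFn]
    rw [← Equiv.eq_symm_apply]
    constructor
    · intro h'
      rw [← h']
    · intro h'
      ext
      exact h'
  constructor
  · rintro ⟨t, ht, hta⟩
    rw [key] at hta
    unfold pos
    omega
  · unfold pos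
    intro h
    refine ⟨(p.symm a : ℕ) - (w.1 - 1), by omega, ?_⟩
    rw [key]
    omega

theorem length_substr (p : Equiv.Perm (Fin n)) {w : ℕ × ℕ} (h1 : 1 ≤ w.1)
    (h2 : w.2 ≤ n + 1) : (substr p w).length = w.2 - w.1 := by
  simp only [substr, List.length_take, List.length_drop, length_str]
  omega

/-! ### Sets of symbols on which two permutations agree -/

/-- `x` and `p` order the symbols in `A` in the same way. -/
def AgreeOn (x p : Equiv.Perm (Fin n)) (A : Finset (Fin n)) : Prop :=
  ∀ a ∈ A, ∀ b ∈ A, pos x a < pos x b → pos p a < pos p b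

theorem AgreeOn.symm {x p : Equiv.Perm (Fin n)} {A : Finset (Fin n)} (h : AgreeOn x p A) :
    AgreeOn p x A := by
  intro a ha b hb hab
  by_contra hlt
  rcases (not_lt.1 hlt).lt_or_eq with h1 | h1
  · exact absurd (h b hb a ha h1) hab.not_gt
  · rw [pos_injective x h1] at hab
    exact lt_irrefl _ hab

theorem AgreeOn.trans_inter {x p q : Equiv.Perm (Fin n)} {A B : Finset (Fin n)}
    (h : AgreeOn x p A) (h' : AgreeOn p q B) : AgreeOn x q (A ∩ B) := by
  intro a ha b hb hab
  rw [Finset.mem_inter] at ha hb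
  exact h' a ha.2 b hb.2 (h a ha.1 b hb.1 hab)

theorem AgreeOn.ed_le {x p : Equiv.Perm (Fin n)} {A : Finset (Fin n)} (h : AgreeOn x p A) :
    ed (str x) (str p) + 2 * A.card ≤ 2 * n := by
  have h1 : ((str x).filter (· ∈ A)).Sublist (str x) := List.filter_sublist
  have hpx := (pairwise_str x).sublist h1
  have hpp : ((str x).filter (· ∈ A)).Pairwise fun a b => pos p a < pos p b := by
    refine List.Pairwise.imp_of_mem ?_ hpx
    intro a b ha hb hab
    simp only [List.mem_filter, decide_eq_true_eq] at ha hb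
    exact h a ha.2 b hb.2 hab
  have h2 := sublist_of_pairwise_pos hpp (pairwise_str p) fun a _ => mem_str p a
  have := ed_add_two_mul_length_le h1 h2
  have hc : ((str x).filter (· ∈ A)).length = A.card := by
    rw [← List.toFinset_card_of_nodup (nodup_of_pairwise_pos hpx)]
    congr 1
    ext a
    simp [mem_str]
  simp only [length_str] at this
  omega

theorem exists_agreeOn (x p : Equiv.Perm (Fin n)) :
    ∃ A : Finset (Fin n), AgreeOn x p A ∧ ed (str x) (str p) + 2 * A.card = 2 * n := by
  obtain ⟨w, hx, hp, h⟩ := exists_ed_add_two_mul_length_eq (str x) (str p)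
  have hwx := (pairwise_str x).sublist hx
  have hwp := (pairwise_str p).sublist hp
  refine ⟨w.toFinset, ?_, ?_⟩
  · let R : Fin n → Fin n → Prop := fun a b =>
      (pos x a < pos x b → pos p a < pos p b) ∧ (pos x b < pos x a → pos p b < pos p a)
    have : Std.Symm R := ⟨fun a b h => ⟨h.2, h.1⟩⟩
    have hR : w.Pairwise R := (hwx.and hwp).imp fun {a b} hab =>
      ⟨fun _ => hab.2, fun h' => absurd hab.1 h'.not_gt⟩
    intro a ha b hb hab
    rw [List.mem_toFinset] at ha hb
    exact (hR.forall_of_forall (fun c _ => ⟨fun h => absurd h (lt_irrefl _),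
      fun h => absurd h (lt_irrefl _)⟩) ha hb).1 hab
  · rw [List.toFinset_card_of_nodup (nodup_of_pairwise_pos hwx)]
    simp only [length_str] at h
    omega

/-- `p` and `q` agree on `A ∩ B`, so `ed p q ≤ 2n - 2|A ∩ B|`; inclusion-exclusion turns the
difference to `ed x p + ed x q` into the size of the complement of `A ∪ B`. -/
theorem two_mul_card_le_slack {x p q : Equiv.Perm (Fin n)} {A B : Finset (Fin n)}
    (hA : AgreeOn x p A) (hAc : ed (str x) (str p) + 2 * A.card = 2 * n)
    (hB : AgreeOn x q B) (hBc : ed (str x) (str q) + 2 * B.card = 2 * n) :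
    2 * ((Aᶜ ∩ Bᶜ).card : ℝ) ≤ slack x p q := by
  have h1 := (hA.symm.trans_inter hB).ed_le
  have h2 := Finset.card_union_add_card_inter A B
  have h3 : (Aᶜ ∩ Bᶜ).card + (A ∪ B).card = n := by
    rw [← Finset.compl_union, add_comm, Finset.card_add_card_compl, Fintype.card_fin]
  have h4 : 2 * (Aᶜ ∩ Bᶜ).card + ed (str p) (str q) ≤ ed (str x) (str p) + ed (str x) (str q) := by
    omega
  have h5 : (2 * (Aᶜ ∩ Bᶜ).card + ed (str p) (str q) : ℝ) ≤
      ed (str x) (str p) + ed (str x) (str q) := by exact_mod_cast h4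
  unfold slack
  linarith

/-! ### Unreliable symbols, slack and stability of near-optimal permutations -/

/-- The symbols missing from at least two of five sets. -/
def unreliable (M : Fin 5 → Finset (Fin n)) : Finset (Fin n) :=
  Finset.univ.filter fun a => 2 ≤ (Finset.univ.filter fun i => a ∉ M i).card

theorem mem_unreliable {M : Fin 5 → Finset (Fin n)} {a : Fin n} :
    a ∈ unreliable M ↔ 2 ≤ (Finset.univ.filter fun i => a ∉ M i).card := by
  simp [unreliable]

theorem card_unreliable_le (M : Fin 5 → Finset (Fin n)) :
    (unreliable M).card ≤ ∑ i, ∑ j ∈ Finset.Ioi i, ((M i)ᶜ ∩ (M j)ᶜ).card := by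
  have h : unreliable M ⊆
      Finset.univ.biUnion fun i => (Finset.Ioi i).biUnion fun j => (M i)ᶜ ∩ (M j)ᶜ := by
    intro a ha
    rw [mem_unreliable] at ha
    obtain ⟨i, hi, j, hj, hij⟩ := Finset.one_lt_card.1 ha
    simp only [Finset.mem_filter, Finset.mem_univ, true_and] at hi hj
    simp only [Finset.mem_biUnion, Finset.mem_univ, true_and, Finset.mem_Ioi, Finset.mem_inter,
      Finset.mem_compl]
    rcases lt_or_gt_of_ne hij with h | h
    · exact ⟨i, j, h, hi, hj⟩
    · exact ⟨j, i, h, hj, hi⟩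
  refine (Finset.card_le_card h).trans (Finset.card_biUnion_le.trans ?_)
  exact Finset.sum_le_sum fun i _ => Finset.card_biUnion_le

theorem two_mul_card_unreliable_le_totalSlack {x : Equiv.Perm (Fin n)}
    {π : Fin 5 → Equiv.Perm (Fin n)} {A : Fin 5 → Finset (Fin n)}
    (hA : ∀ i, AgreeOn x (π i) (A i))
    (hAc : ∀ i, ed (str x) (str (π i)) + 2 * (A i).card = 2 * n) :
    2 * ((unreliable A).card : ℝ) ≤ totalSlack π x := by
  have h : ((unreliable A).card : ℝ) ≤
      ∑ i, ∑ j ∈ Finset.Ioi i, (((A i)ᶜ ∩ (A j)ᶜ).card : ℝ) := by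
    exact_mod_cast card_unreliable_le A
  calc 2 * ((unreliable A).card : ℝ)
      ≤ 2 * ∑ i, ∑ j ∈ Finset.Ioi i, (((A i)ᶜ ∩ (A j)ᶜ).card : ℝ) := by linarith
    _ = ∑ i, ∑ j ∈ Finset.Ioi i, 2 * (((A i)ᶜ ∩ (A j)ᶜ).card : ℝ) := by
        simp only [Finset.mul_sum]
    _ ≤ totalSlack π x := Finset.sum_le_sum fun i _ => Finset.sum_le_sum fun j _ =>
        two_mul_card_le_slack (hA i) (hAc i) (hA j) (hAc j)

/-- Each index lies in four of the ten pairs. The subtracted term does not depend on `x`, so slacks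
of two permutations differ by four times the difference of their total distances. -/
theorem totalSlack_eq (π : Fin 5 → Equiv.Perm (Fin n)) (x : Equiv.Perm (Fin n)) :
    totalSlack π x = 4 * ∑ i, (ed (str x) (str (π i)) : ℝ) -
      ∑ i, ∑ j ∈ Finset.Ioi i, (ed (str (π i)) (str (π j)) : ℝ) := by
  have h : ∀ f : Fin 5 → ℝ, ∑ i, ∑ j ∈ Finset.Ioi i, (f i + f j) = 4 * ∑ i, f i := by
    intro f
    have h0 : Finset.Ioi (0 : Fin 5) = {1, 2, 3, 4} := by decide
    have h1 : Finset.Ioi (1 : Fin 5) = {2, 3, 4} := by decide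
    have h2 : Finset.Ioi (2 : Fin 5) = {3, 4} := by decide
    have h3 : Finset.Ioi (3 : Fin 5) = {4} := by decide
    have h4 : Finset.Ioi (4 : Fin 5) = ∅ := by decide
    simp only [Fin.sum_univ_five, h0, h1, h2, h3, h4]
    simp
    ring
  unfold totalSlack slack
  simp only [Finset.sum_sub_distrib, h]

/-- Each of the four hypotheses rules out at most one index, and there are five. This is where five
inputs are needed. -/
theorem exists_mem_of_not_mem_unreliable {M N : Fin 5 → Finset (Fin n)} {a b : Fin n}
    (ha : a ∉ unreliable M) (hb : b ∉ unreliable M) (ha' : a ∉ unreliable N)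
    (hb' : b ∉ unreliable N) : ∃ i, a ∈ M i ∧ b ∈ M i ∧ a ∈ N i ∧ b ∈ N i := by
  simp only [mem_unreliable, not_le] at ha hb ha' hb'
  by_contra! hcon
  have hsub : (Finset.univ : Finset (Fin 5)) ⊆
      ((Finset.univ.filter fun i => a ∉ M i) ∪ (Finset.univ.filter fun i => b ∉ M i)) ∪
      ((Finset.univ.filter fun i => a ∉ N i) ∪ (Finset.univ.filter fun i => b ∉ N i)) := by
    intro i _
    simp only [Finset.mem_union, Finset.mem_filter, Finset.mem_univ, true_and]
    have := hcon i
    tauto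
  have h1 := Finset.card_le_card hsub
  have h2 := Finset.card_union_le
    ((Finset.univ.filter fun i => a ∉ M i) ∪ (Finset.univ.filter fun i => b ∉ M i))
    ((Finset.univ.filter fun i => a ∉ N i) ∪ (Finset.univ.filter fun i => b ∉ N i))
  have h3 := Finset.card_union_le (Finset.univ.filter fun i => a ∉ M i)
    (Finset.univ.filter fun i => b ∉ M i)
  have h4 := Finset.card_union_le (Finset.univ.filter fun i => a ∉ N i)
    (Finset.univ.filter fun i => b ∉ N i)
  simp only [Finset.card_univ, Fintype.card_fin] at h1
  omega

theorem ed_le_totalSlack_add_totalSlack (π : Fin 5 → Equiv.Perm (Fin n))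
    (x y : Equiv.Perm (Fin n)) :
    (ed (str y) (str x) : ℝ) ≤ totalSlack π x + totalSlack π y := by
  choose A hA hAc using fun i => exists_agreeOn x (π i)
  choose B hB hBc using fun i => exists_agreeOn y (π i)
  have hx := two_mul_card_unreliable_le_totalSlack hA hAc
  have hy := two_mul_card_unreliable_le_totalSlack hB hBc
  have hagree : AgreeOn y x (unreliable A ∪ unreliable B)ᶜ := by
    intro a ha b hb hab
    simp only [Finset.mem_compl, Finset.mem_union, not_or] at ha hb
    obtain ⟨i, h1, h2, h3, h4⟩ := exists_mem_of_not_mem_unreliable ha.1 hb.1 ha.2 hb.2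
    exact (hA i).symm a h1 b h2 (hB i a h3 b h4 hab)
  have h := hagree.ed_le
  have h1 := Finset.card_add_card_compl (unreliable A ∪ unreliable B)
  have h2 := Finset.card_union_le (unreliable A) (unreliable B)
  rw [Fintype.card_fin] at h1
  have h3 : ed (str y) (str x) ≤ 2 * (unreliable A).card + 2 * (unreliable B).card := by omega
  have h4 : (ed (str y) (str x) : ℝ) ≤ 2 * (unreliable A).card + 2 * (unreliable B).card := by
    exact_mod_cast h3
  linarith

/-- A permutation whose total distance to the inputs is nearly that of `x` is close to `x`. -/
theorem ed_le_of_sum_ed_le {π : Fin 5 → Equiv.Perm (Fin n)} {x y : Equiv.Perm (Fin n)} {α : ℝ}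
    (h : ∑ i, (ed (str y) (str (π i)) : ℝ) ≤ ∑ i, (ed (str x) (str (π i)) : ℝ) + α) :
    (ed (str y) (str x) : ℝ) ≤ 2 * totalSlack π x + 4 * α := by
  have h1 := ed_le_totalSlack_add_totalSlack π x y
  have h2 := totalSlack_eq π x
  have h3 := totalSlack_eq π y
  linarith

/-! ### Block reconstruction: existence -/

theorem exists_loopResult {α : Type*} {step : Finset α → Finset α → Prop}
    (h : ∀ V W, step V W → W ⊂ V) (V : Finset α) : ∃ W, LoopResult step V W := by
  induction V using Finset.strongInduction with
  | H V ih =>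
    by_cases hV : ∃ W, step V W
    · obtain ⟨W, hW⟩ := hV
      obtain ⟨U, hU, hU'⟩ := ih W (h V W hW)
      exact ⟨U, Relation.ReflTransGen.head hW hU, hU'⟩
    · exact ⟨V, Relation.ReflTransGen.refl, not_exists.1 hV⟩

theorem PairStep.ssubset {S : Fin 5 → List (Fin n)} {V W : Finset (Fin n)}
    (h : PairStep S V W) : W ⊂ V := by
  obtain ⟨a, ha, b, -, -, -, -, rfl⟩ := h
  exact Finset.ssubset_iff_subset_ne.2 ⟨Finset.sdiff_subset, fun h => by
    have := h ▸ ha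
    simp at this⟩

theorem TriangleStep.ssubset {S : Fin 5 → List (Fin n)} {V W : Finset (Fin n)}
    (h : TriangleStep S V W) : W ⊂ V := by
  obtain ⟨a, ha, b, -, c, -, -, -, -, rfl⟩ := h
  exact Finset.ssubset_iff_subset_ne.2 ⟨Finset.sdiff_subset, fun h => by
    have := h ▸ ha
    simp at this⟩

theorem LoopResult.subset {α : Type*} {step : Finset α → Finset α → Prop}
    (h : ∀ V W, step V W → W ⊂ V) {V W : Finset α} (hVW : LoopResult step V W) : W ⊆ V := by
  obtain ⟨h1, -⟩ := hVW
  induction h1 with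
  | refl => exact Finset.Subset.refl _
  | tail _ hs ih => exact (h _ _ hs).subset.trans ih

theorem Edge.asymm {S : Fin 5 → List (Fin n)} {a b : Fin n} (h : Edge S a b) : ¬ Edge S b a :=
  fun h' => lt_asymm h h'

open Classical in
-- A tournament without directed triangles is transitive, so insertion sort by the non-strict
-- relation applies.
theorem exists_isTopologicalSort {S : Fin 5 → List (Fin n)} {W : Finset (Fin n)}
    (hpair : ∀ a ∈ W, ∀ b ∈ W, a ≠ b → Edge S a b ∨ Edge S b a)
    (htri : ∀ U, ¬ TriangleStep S W U) : ∃ t, IsTopologicalSort S W t := by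
  let r : {a // a ∈ W} → {a // a ∈ W} → Prop := fun a b => ¬ Edge S b.1 a.1
  have hr : ∀ a b : {a // a ∈ W}, r a b → a = b ∨ Edge S a.1 b.1 := by
    intro a b h
    by_cases hab : a = b
    · exact Or.inl hab
    · exact Or.inr ((hpair a.1 a.2 b.1 b.2 fun e => hab (Subtype.ext e)).resolve_right h)
  have : Std.Total r := ⟨fun a b => by
    by_cases h : Edge S b.1 a.1
    · exact Or.inr h.asymm
    · exact Or.inl h⟩
  have : IsTrans _ r := ⟨fun a b c hab hbc => by
    rcases hr a b hab with rfl | hab'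
    · exact hbc
    rcases hr b c hbc with rfl | hbc'
    · exact hab
    exact fun hca => htri _ ⟨a.1, a.2, b.1, b.2, c.1, c.2, hab', hbc', hca, rfl⟩⟩
  have hperm := List.perm_insertionSort r W.attach.toList
  refine ⟨(W.attach.toList.insertionSort r).map Subtype.val, ?_, ?_, ?_⟩
  · exact (hperm.nodup_iff.2 (Finset.nodup_toList _)).map Subtype.val_injective
  · ext a
    simp
  · rw [List.pairwise_map]
    exact List.pairwise_insertionSort r _

theorem exists_isReconstruction (S : Fin 5 → List (Fin n)) (B : ℕ) :
    ∃ z, IsReconstruction S B z := by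
  obtain ⟨V, hV⟩ := exists_loopResult (step := PairStep S) (fun _ _ h => h.ssubset) (vertices S)
  obtain ⟨W, hW⟩ := exists_loopResult (step := TriangleStep S) (fun _ _ h => h.ssubset) V
  have hsub : W ⊆ V := hW.subset fun _ _ h => h.ssubset
  have hpair : ∀ a ∈ W, ∀ b ∈ W, a ≠ b → Edge S a b ∨ Edge S b a := by
    intro a ha b hb hab
    by_contra! hcon
    exact hV.2 _ ⟨a, hsub ha, b, hsub hb, hab, hcon.1, hcon.2, rfl⟩
  obtain ⟨t, ht⟩ := exists_isTopologicalSort hpair hW.2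
  exact ⟨_, V, W, t, hV, hW, ht, rfl⟩

/-! ### Block reconstruction: quality -/

theorem mem_vertices {S : Fin 5 → List (Fin n)} {a : Fin n} :
    a ∈ vertices S ↔ 4 ≤ (Finset.univ.filter fun i => a ∈ S i).card := by
  simp [vertices]

theorem IsReconstruction.exists_list {S : Fin 5 → List (Fin n)} {B : ℕ}
    {z : List (Option (Fin n))} (hz : IsReconstruction S B z) :
    ∃ t : List (Fin n), t.Nodup ∧ t.toFinset ⊆ vertices S ∧
      z = t.map some ++ List.replicate (B - t.length) none := by
  obtain ⟨V, W, t, hV, hW, ht, rfl⟩ := hz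
  refine ⟨t, ht.1, ?_, rfl⟩
  rw [ht.2.1]
  exact (hW.subset fun _ _ h => h.ssubset).trans (hV.subset fun _ _ h => h.ssubset)

theorem card_filter_add_card_filter_not (P : Fin 5 → Prop) [DecidablePred P] :
    (Finset.univ.filter fun i => P i).card + (Finset.univ.filter fun i => ¬ P i).card = 5 := by
  rw [Finset.card_filter_add_card_filter_not]
  simp

/-- Each of the two reliable symbols is unmatched in at most one string. So at least three strings
contain both in the order of `x`, and at most two can show the reverse. -/
theorem edge_of_pos_lt {x : Equiv.Perm (Fin n)} {p : Fin 5 → Equiv.Perm (Fin n)}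
    {S : Fin 5 → List (Fin n)} (hS : ∀ i, (S i).Pairwise fun a b => pos (p i) a < pos (p i) b)
    {X : Finset (Fin n)} {M : Fin 5 → Finset (Fin n)} (hM : ∀ i, AgreeOn x (p i) (M i))
    (hMS : ∀ i, M i ∩ X ⊆ (S i).toFinset) {a b : Fin n} (ha : a ∈ X \ unreliable M)
    (hb : b ∈ X \ unreliable M) (hab : pos x a < pos x b) : Edge S a b := by
  simp only [Finset.mem_sdiff, mem_unreliable, not_le] at ha hb
  have h1 : countBefore S b a ≤
      (Finset.univ.filter fun i => ¬ (a ∈ M i ∧ b ∈ M i)).card := by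
    refine Finset.card_le_card ?_
    intro i hi
    simp only [Finset.mem_filter, Finset.mem_univ, true_and] at hi ⊢
    intro hi'
    exact absurd (hM i a hi'.1 b hi'.2 hab) ((pair_sublist_iff (hS i)).1 hi).2.2.not_gt
  have h2 : (Finset.univ.filter fun i => a ∈ M i ∧ b ∈ M i).card ≤ countBefore S a b := by
    refine Finset.card_le_card ?_
    intro i hi
    simp only [Finset.mem_filter, Finset.mem_univ, true_and] at hi ⊢
    refine (pair_sublist_iff (hS i)).2 ⟨?_, ?_, hM i a hi.1 b hi.2 hab⟩
    · exact List.mem_toFinset.1 (hMS i (Finset.mem_inter.2 ⟨hi.1, ha.1⟩))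
    · exact List.mem_toFinset.1 (hMS i (Finset.mem_inter.2 ⟨hi.2, hb.1⟩))
  have h3 := card_filter_add_card_filter_not fun i => a ∈ M i ∧ b ∈ M i
  have h4 : (Finset.univ.filter fun i => ¬ (a ∈ M i ∧ b ∈ M i)).card ≤
      (Finset.univ.filter fun i => a ∉ M i).card + (Finset.univ.filter fun i => b ∉ M i).card := by
    refine (Finset.card_le_card ?_).trans (Finset.card_union_le _ _)
    intro i hi
    simp only [Finset.mem_filter, Finset.mem_univ, true_and, Finset.mem_union] at hi ⊢
    tauto
  unfold Edge
  omega

/-- Every vertex outside of `G` removed on the way from `V` to `W` pays for at most two removed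
vertices of `G`. -/
def RemovalBound (G V W : Finset (Fin n)) : Prop :=
  W ⊆ V ∧ (V ∩ G).card + 2 * (W \ G).card ≤ (W ∩ G).card + 2 * (V \ G).card

theorem RemovalBound.trans {G U V W : Finset (Fin n)} (h : RemovalBound G U V)
    (h' : RemovalBound G V W) : RemovalBound G U W :=
  ⟨h'.1.trans h.1, by have := h.2; have := h'.2; omega⟩

/-- Of at most three deleted vertices one lies outside `G`, so at most two lie inside. -/
theorem removalBound_sdiff {G V T : Finset (Fin n)} (hT : T ⊆ V) (hcard : T.card ≤ 3)
    (hG : ∃ c ∈ T, c ∉ G) : RemovalBound G V (V \ T) := by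
  refine ⟨Finset.sdiff_subset, ?_⟩
  obtain ⟨c, hc, hcG⟩ := hG
  have h1 : (T \ G).card + (T ∩ G).card = T.card := Finset.card_sdiff_add_card_inter T G
  have h2 : 0 < (T \ G).card := Finset.card_pos.2 ⟨c, Finset.mem_sdiff.2 ⟨hc, hcG⟩⟩
  have h3 : ((V \ T) ∩ G).card + (T ∩ G).card = (V ∩ G).card := by
    rw [← Finset.card_union_of_disjoint]
    · congr 1
      ext a
      have := @hT a
      simp only [Finset.mem_union, Finset.mem_inter, Finset.mem_sdiff]
      tauto
    · rw [Finset.disjoint_left]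
      intro a
      simp only [Finset.mem_inter, Finset.mem_sdiff]
      tauto
  have h4 : ((V \ T) \ G).card + (T \ G).card = (V \ G).card := by
    rw [← Finset.card_union_of_disjoint]
    · congr 1
      ext a
      have := @hT a
      simp only [Finset.mem_union, Finset.mem_sdiff]
      tauto
    · rw [Finset.disjoint_left]
      intro a
      simp only [Finset.mem_sdiff]
      tauto
  omega

theorem LoopResult.removalBound {G : Finset (Fin n)}
    {step : Finset (Fin n) → Finset (Fin n) → Prop}
    (h : ∀ V W, step V W → RemovalBound G V W) {V W : Finset (Fin n)}
    (hVW : LoopResult step V W) : RemovalBound G V W := by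
  obtain ⟨h1, -⟩ := hVW
  induction h1 with
  | refl => exact ⟨Finset.Subset.refl _, le_rfl⟩
  | tail _ hs ih => exact ih.trans (h _ _ hs)

/-- `X` is the symbol set of a block of `x`, and `|X| + |S i| - 2|M i ∩ X|` is the cost of matching
that block itself. The excess counts reliable symbols of `X` as good: each other symbol of `X` costs
2, and each unreliable vertex costs 4, as it may take two good vertices with it. -/
theorem IsReconstruction.ed_add_le {x : Equiv.Perm (Fin n)} {p : Fin 5 → Equiv.Perm (Fin n)}
    {S : Fin 5 → List (Fin n)} (hS : ∀ i, (S i).Pairwise fun a b => pos (p i) a < pos (p i) b)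
    {X : Finset (Fin n)} {M : Fin 5 → Finset (Fin n)} (hM : ∀ i, AgreeOn x (p i) (M i))
    (hMS : ∀ i, M i ∩ X ⊆ (S i).toFinset) (hV : vertices S \ X ⊆ unreliable M)
    {z : List (Option (Fin n))} (hz : IsReconstruction S X.card z) (i : Fin 5) :
    ed z ((S i).map some) + 2 * (M i ∩ X).card ≤ X.card + (S i).length +
      (2 * (X ∩ unreliable M).card + 4 * (vertices S ∩ unreliable M).card) := by
  obtain ⟨V, W, t, hVl, hWl, ht, rfl⟩ := hz
  set G := X \ unreliable M with hG
  have hedge : ∀ {a b}, a ∈ G → b ∈ G → pos x a < pos x b → Edge S a b := fun ha hb hab =>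
    edge_of_pos_lt hS hM hMS ha hb hab
  have hlt : ∀ {a b}, a ∈ G → b ∈ G → Edge S a b → pos x a < pos x b := by
    intro a b ha hb hab
    by_contra! hle
    rcases hle.lt_or_eq with h | h
    · exact (hedge hb ha h).asymm hab
    · rw [pos_injective x h] at hab
      exact hab.asymm hab
  -- On `G` the majority graph is the total order of `x`, so no deleted pair or triangle lies inside
  -- `G`.
  have hrem : RemovalBound G (vertices S) W := by
    refine (hVl.removalBound ?_).trans (hWl.removalBound ?_)
    · rintro V W ⟨a, ha, b, hb, hab, h1, h2, rfl⟩
      refine removalBound_sdiff ?_ (Finset.card_le_two.trans (by norm_num)) ?_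
      · intro c hc
        simp only [Finset.mem_insert, Finset.mem_singleton] at hc
        rcases hc with rfl | rfl <;> assumption
      · by_contra! hcon
        have haG := hcon a (by simp)
        have hbG := hcon b (by simp)
        rcases lt_or_gt_of_ne fun e => hab (pos_injective x e) with h | h
        · exact h1 (hedge haG hbG h)
        · exact h2 (hedge hbG haG h)
    · rintro V W ⟨a, ha, b, hb, c, hc, h1, h2, h3, rfl⟩
      refine removalBound_sdiff ?_ Finset.card_le_three ?_
      · intro d hd
        simp only [Finset.mem_insert, Finset.mem_singleton] at hd
        rcases hd with rfl | rfl | rfl <;> assumption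
      · by_contra! hcon
        have haG := hcon a (by simp)
        have hbG := hcon b (by simp)
        have hcG := hcon c (by simp)
        exact lt_asymm ((hlt haG hbG h1).trans (hlt hbG hcG h2)) (hlt hcG haG h3)
  have hGV : G ⊆ vertices S := by
    intro a ha
    rw [hG, Finset.mem_sdiff, mem_unreliable, not_le] at ha
    rw [mem_vertices]
    have h1 := card_filter_add_card_filter_not fun i => a ∈ M i
    have h2 : (Finset.univ.filter fun i => a ∈ M i).card ≤
        (Finset.univ.filter fun i => a ∈ S i).card := by
      refine Finset.card_le_card fun i hi => ?_
      simp only [Finset.mem_filter, Finset.mem_univ, true_and] at hi ⊢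
      exact List.mem_toFinset.1 (hMS i (Finset.mem_inter.2 ⟨hi, ha.1⟩))
    omega
  have hVG : vertices S \ G ⊆ vertices S ∩ unreliable M := by
    intro a ha
    rw [Finset.mem_sdiff] at ha
    refine Finset.mem_inter.2 ⟨ha.1, ?_⟩
    by_cases haX : a ∈ X
    · by_contra hcon
      exact ha.2 (Finset.mem_sdiff.2 ⟨haX, hcon⟩)
    · exact hV (Finset.mem_sdiff.2 ⟨ha.1, haX⟩)
  -- a common subsequence
  let l := t.filter fun a => a ∈ W ∩ G ∩ M i
  have hlt' : l.Sublist t := List.filter_sublist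
  have hmem : ∀ {a}, a ∈ l → a ∈ G ∧ a ∈ M i := by
    intro a ha
    simp only [l, List.mem_filter, decide_eq_true_eq, Finset.mem_inter] at ha
    exact ⟨ha.2.1.2, ha.2.2⟩
  have hlp : l.Pairwise fun a b => pos (p i) a < pos (p i) b := by
    have h1 : l.Pairwise fun a b => a ≠ b ∧ ¬ Edge S b a :=
      List.Pairwise.and (ht.1.sublist hlt') (ht.2.2.sublist hlt')
    refine List.Pairwise.imp_of_mem ?_ h1
    intro a b ha hb hab
    refine hM i a (hmem ha).2 b (hmem hb).2 ?_
    rcases lt_or_gt_of_ne fun e => hab.1 (pos_injective x e) with h | h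
    · exact h
    · exact absurd (hedge (hmem hb).1 (hmem ha).1 h) hab.2
  have hlS : l.Sublist (S i) := by
    refine sublist_of_pairwise_pos hlp (hS i) fun a ha => ?_
    exact List.mem_toFinset.1 (hMS i (Finset.mem_inter.2
      ⟨(hmem ha).2, (Finset.mem_sdiff.1 (hmem ha).1).1⟩))
  have hlc : l.length = (W ∩ G ∩ M i).card := by
    rw [← List.toFinset_card_of_nodup (ht.1.sublist hlt')]
    congr 1
    ext a
    have : a ∈ t ↔ a ∈ W := by rw [← ht.2.1, List.mem_toFinset]
    simp only [l, List.mem_toFinset, List.mem_filter, decide_eq_true_eq, Finset.mem_inter, this]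
    tauto
  have hed := ed_add_two_mul_length_le
    (((hlt'.map some).trans (List.sublist_append_left (t.map some)
      (List.replicate (X.card - t.length) none)))) (hlS.map some)
  have htW : t.length = W.card := by rw [← ht.2.1, List.toFinset_card_of_nodup ht.1]
  simp only [List.length_append, List.length_map, List.length_replicate, hlc, htW] at hed
  rw [htW]
  have c1 : (M i ∩ X).card + (W ∩ G).card ≤ X.card + (W ∩ G ∩ M i).card := by
    have := Finset.card_union_add_card_inter (M i ∩ X) (W ∩ G)
    have e1 : (M i ∩ X ∪ W ∩ G).card ≤ X.card := Finset.card_le_card (by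
      intro a
      simp only [hG, Finset.mem_union, Finset.mem_inter, Finset.mem_sdiff]
      tauto)
    have e2 : (M i ∩ X) ∩ (W ∩ G) ⊆ W ∩ G ∩ M i := by
      intro a
      simp only [Finset.mem_inter]
      tauto
    have := Finset.card_le_card e2
    omega
  have c2 : G.card + (X ∩ unreliable M).card = X.card :=
    Finset.card_sdiff_add_card_inter X (unreliable M)
  have c3 := hrem.2
  rw [Finset.inter_eq_right.2 hGV] at c3
  have c4 := Finset.card_le_card hVG
  have c5 : (W \ G).card + (W ∩ G).card = W.card := Finset.card_sdiff_add_card_inter W G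
  -- The candidate has `max |W| |X|` symbols. Its excess over `|X|` is at most `|W \ G|`, which the
  -- term `2|W \ G|` in `RemovalBound` pays for.
  omega

/-! ### Blocks -/

theorem blockStart_zero (n K : ℕ) : blockStart n K 0 = 1 := by simp [blockStart]

theorem blockStart_self (n : ℕ) {K : ℕ} (hK : 0 < K) : blockStart n K K = n + 1 := by
  simp [blockStart, Nat.mul_div_cancel_left n hK]

theorem blockStart_mono (n K : ℕ) : Monotone (blockStart n K) := fun i j h => by
  unfold blockStart
  gcongr

theorem one_le_blockStart (n K j : ℕ) : 1 ≤ blockStart n K j := Nat.le_add_left _ _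

theorem blockStart_le (n : ℕ) {K j : ℕ} (hK : 0 < K) (hj : j ≤ K) : blockStart n K j ≤ n + 1 :=
  (blockStart_mono n K hj).trans_eq (blockStart_self n hK)

theorem sum_blockSize (n : ℕ) {K : ℕ} (hK : 0 < K) :
    ∑ j ∈ Finset.range K, blockSize n K j = n := by
  unfold blockSize
  rw [Finset.sum_range_tsub (blockStart_mono n K), blockStart_zero, blockStart_self n hK]
  simp

/-- The index of the block that contains position `t`. -/
def blockIndex (n K t : ℕ) : ℕ := (t * K - 1) / n

/-- Both sides say `j * n < t * K`; this explains the `- 1` in `blockIndex`. -/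
theorem blockStart_le_iff {n K t : ℕ} (hn : 0 < n) (hK : 0 < K) (ht : 1 ≤ t) (j : ℕ) :
    blockStart n K j ≤ t ↔ j ≤ blockIndex n K t := by
  have h1 : 1 ≤ t * K := Nat.mul_pos ht hK
  unfold blockStart blockIndex
  rw [Nat.le_div_iff_mul_le hn, Nat.succ_le_iff, Nat.div_lt_iff_lt_mul hK]
  omega

theorem blockIndex_eq_iff {n K t : ℕ} (hn : 0 < n) (hK : 0 < K) (ht : 1 ≤ t) (j : ℕ) :
    blockIndex n K t = j ↔ blockStart n K j ≤ t ∧ t < blockStart n K (j + 1) := by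
  rw [← not_le, blockStart_le_iff hn hK ht, blockStart_le_iff hn hK ht]
  omega

theorem blockIndex_lt {n K t : ℕ} (hn : 0 < n) (hK : 0 < K) (ht : 1 ≤ t) (ht' : t < n + 1) :
    blockIndex n K t < K := by
  rw [← not_le, ← blockStart_le_iff hn hK ht, blockStart_self n hK]
  omega

theorem numBlocks_pos {n : ℕ} (hn : 0 < n) {ε : ℝ} (hε : 0 ≤ ε) : 0 < numBlocks n ε := by
  unfold numBlocks
  rw [Nat.floor_pos]
  exact Real.one_le_rpow (by exact_mod_cast hn) hε

/-! ### Scales -/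

theorem rho_pos : 0 < rho := by norm_num [rho]

theorem isScale_zero {n : ℕ} (hn : 0 < n) : IsScale n 0 := by
  have h1 : (1 : ℝ) ≤ n := by exact_mod_cast hn
  have h2 : 0 ≤ Real.logb (1 + rho) (2 * n) :=
    Real.logb_nonneg (by linarith [rho_pos]) (by linarith)
  unfold IsScale
  exact_mod_cast Int.ceil_nonneg h2

theorem gap_zero {n : ℕ} (hn : 0 < n) {ε : ℝ} (hε : 0 ≤ ε) : gap n ε 0 = 1 := by
  have h1 : (n : ℝ) ^ (-ε) ≤ 1 :=
    Real.rpow_le_one_of_one_le_of_nonpos (by exact_mod_cast hn) (by linarith)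
  have h2 : ⌊rho * (1 + rho) ^ 0 * (n : ℝ) ^ (-ε)⌋₊ = 0 := by
    rw [Nat.floor_eq_zero, pow_zero, mul_one]
    have : rho * (n : ℝ) ^ (-ε) ≤ rho * 1 := mul_le_mul_of_nonneg_left h1 rho_pos.le
    have : rho < 1 := by norm_num [rho]
    linarith
  rw [gap, h2]
  rfl

theorem one_le_gap (n : ℕ) (ε : ℝ) (k : ℕ) : 1 ≤ gap n ε k := le_max_left _ _

theorem gap_sub_one_le (n : ℕ) (ε : ℝ) (k : ℕ) :
    ((gap n ε k - 1 : ℕ) : ℝ) ≤ rho * (1 + rho) ^ k * (n : ℝ) ^ (-ε) := by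
  have h0 : 0 ≤ rho * (1 + rho) ^ k * (n : ℝ) ^ (-ε) := by
    have := rho_pos
    positivity
  unfold gap
  rcases le_total ⌊rho * (1 + rho) ^ k * (n : ℝ) ^ (-ε)⌋₊ 1 with h | h
  · rw [max_eq_left h]
    simpa using h0
  · rw [max_eq_right h]
    refine le_trans ?_ (Nat.floor_le h0)
    exact_mod_cast Nat.sub_le _ _

/-- Rounding to a multiple of the gap moves a position by at most `gap - 1`, which vanishes when the
maximum with 1 takes effect. Over all blocks the displacement is thus a `ρ` fraction of the scale,
without additive error. -/
theorem numBlocks_mul_gap_sub_one_le {n : ℕ} (hn : 0 < n) (ε : ℝ) (k : ℕ) :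
    (numBlocks n ε : ℝ) * ((gap n ε k - 1 : ℕ) : ℝ) ≤ rho * (1 + rho) ^ k := by
  have hn' : (0 : ℝ) < n := by exact_mod_cast hn
  have h1 : (numBlocks n ε : ℝ) ≤ (n : ℝ) ^ ε := Nat.floor_le (by positivity)
  have hrho := rho_pos
  calc (numBlocks n ε : ℝ) * ((gap n ε k - 1 : ℕ) : ℝ)
      ≤ (n : ℝ) ^ ε * (rho * (1 + rho) ^ k * (n : ℝ) ^ (-ε)) :=
        mul_le_mul h1 (gap_sub_one_le n ε k) (by positivity) (by positivity)
    _ = rho * (1 + rho) ^ k * ((n : ℝ) ^ ε * (n : ℝ) ^ (-ε)) := by ring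
    _ = rho * (1 + rho) ^ k := by
        rw [← Real.rpow_add hn', add_neg_cancel, Real.rpow_zero, mul_one]

theorem one_lt_one_add_rho : 1 < 1 + rho := by linarith [rho_pos]

/-- A scale that suits a permutation with `h` unaligned symbols. -/
theorem exists_scale {n : ℕ} (hn : 0 < n) {ε : ℝ} (hε : 0 ≤ ε) {h : ℕ} (hh : h ≤ n) :
    ∃ k, IsScale n k ∧ (h : ℝ) + (gap n ε k - 1 : ℕ) ≤ (1 + rho) ^ k ∧
      (0 < h → (h : ℝ) + 2 * (gap n ε k - 1 : ℕ) + 1 ≤ (1 + rho) ^ k) ∧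
      2 * (numBlocks n ε : ℝ) * (gap n ε k - 1 : ℕ) ≤ 5 * rho * h ∧ gap n ε k ≤ n + 1 := by
  classical
  have hrho := rho_pos
  have hrho' : rho = 0.000001 := rfl
  have hex : ∃ k : ℕ, 2 * (h : ℝ) ≤ (1 + rho) ^ k :=
    ((tendsto_pow_atTop_atTop_of_one_lt one_lt_one_add_rho).eventually_ge_atTop _).exists
  have hhn : (h : ℝ) ≤ n := by exact_mod_cast hh
  have hn' : (1 : ℝ) ≤ n := by exact_mod_cast hn
  -- The least scale `≥ 2h`. It is below `2(1 + ρ)h` up to equality unless `k = 0`, where the gap is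
  -- 1 and rounding is free. The factor 2 makes room for the additive terms.
  set k := Nat.find hex with hk
  have hk1 : 2 * (h : ℝ) ≤ (1 + rho) ^ k := Nat.find_spec hex
  have hK1 : (1 : ℝ) ≤ numBlocks n ε := by exact_mod_cast numBlocks_pos hn hε
  have hKg := numBlocks_mul_gap_sub_one_le hn ε k
  set G : ℝ := ((gap n ε k - 1 : ℕ) : ℝ) with hG
  have hG0 : 0 ≤ G := Nat.cast_nonneg _
  have hGN : G ≤ rho * (1 + rho) ^ k := by nlinarith
  have hGcases : G = 0 ∨ 1 ≤ G := by
    rcases Nat.eq_zero_or_pos (gap n ε k - 1) with h0 | h0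
    · exact Or.inl (by rw [hG, h0]; simp)
    · exact Or.inr (by rw [hG]; exact_mod_cast h0)
  have hN0 : 0 < (1 + rho) ^ k := by positivity
  have hsmall : rho * (1 + rho) ^ k ≤ (1 + rho) ^ k / 1000 := by
    rw [hrho'] at hN0 ⊢
    linarith
  have hscale : IsScale n k ∧ 2 * (numBlocks n ε : ℝ) * G ≤ 5 * rho * h := by
    rcases Nat.eq_zero_or_pos k with h0 | h0
    · rw [hG, h0, gap_zero hn hε]
      refine ⟨isScale_zero hn, ?_⟩
      simp only [Nat.sub_self, Nat.cast_zero, mul_zero]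
      positivity
    · have hlt : (1 + rho) ^ (k - 1) < 2 * (h : ℝ) :=
        not_le.1 (Nat.find_min hex (m := k - 1) (by omega))
      have hpow : (1 + rho) ^ k = (1 + rho) * (1 + rho) ^ (k - 1) := by
        rw [← pow_succ', Nat.sub_add_cancel h0]
      constructor
      · have h1 : ((k - 1 : ℕ) : ℝ) < Real.logb (1 + rho) (2 * n) := by
          rw [Real.lt_logb_iff_rpow_lt one_lt_one_add_rho (by linarith), Real.rpow_natCast]
          linarith
        have h2 : (((k - 1 : ℕ) : ℤ) : ℝ) < (⌈Real.logb (1 + rho) (2 * n)⌉ : ℤ) :=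
          lt_of_lt_of_le (by exact_mod_cast h1) (Int.le_ceil _)
        have h3 := Int.cast_lt.1 h2
        unfold IsScale
        omega
      · have h1 : (1 + rho) ^ k ≤ (1 + rho) * (2 * h) := by
          rw [hpow]
          exact mul_le_mul_of_nonneg_left hlt.le (by linarith)
        have h2 : rho * (1 + rho) ^ k ≤ rho * ((1 + rho) * (2 * h)) :=
          mul_le_mul_of_nonneg_left h1 hrho.le
        have h3 : (1 + rho) * (2 * h) ≤ 5 / 2 * h := by
          have : (0 : ℝ) ≤ h := Nat.cast_nonneg _
          rw [hrho']
          linarith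
        have h4 := mul_le_mul_of_nonneg_left h3 hrho.le
        linarith
  refine ⟨k, hscale.1, ?_, ?_, hscale.2, ?_⟩
  · linarith
  · intro hpos
    have hpos' : (1 : ℝ) ≤ h := by exact_mod_cast hpos
    -- Without rounding, `h + 1 ≤ 2h`. Otherwise `1 ≤ G`, and `3G` is a tiny part of the scale.
    rcases hGcases with h0 | h0 <;> linarith
  · have h1 : G ≤ n := by
      have h2 : G ≤ 5 * rho * h := by nlinarith [hscale.2]
      rw [hrho'] at h2
      linarith
    have h2 : gap n ε k - 1 ≤ n := Nat.cast_le.1 h1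
    omega

/-! ### End positions -/

theorem natCast_le_logb {a : ℕ} {y : ℝ} (h : (1 + rho) ^ a ≤ y) :
    (a : ℝ) ≤ Real.logb (1 + rho) y := by
  rw [Real.le_logb_iff_rpow_le one_lt_one_add_rho
    (lt_of_lt_of_le (by have := rho_pos; positivity) h), Real.rpow_natCast]
  exact h

/-- An available end position `e ≤ f`, such that shortening `[s, f)` to `[s, e)` loses little. -/
theorem exists_end {B k s f : ℕ} (hsf : s ≤ f)
    (hN : s + B < f → ((f - s - B : ℕ) : ℝ) + 1 ≤ (1 + rho) ^ k) :
    ∃ e, s ≤ e ∧ e ≤ f ∧ (IsEnd B k s e ∨ s = e) ∧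
      (((f - e : ℕ) : ℝ) ≤ 2 * rho * |((f - s : ℕ) : ℝ) - B| ∨
        (B : ℝ) ≤ 2 * rho * |((f - s : ℕ) : ℝ) - B|) := by
  classical
  have hrho := rho_pos
  have hrho' : rho = 0.000001 := rfl
  obtain ⟨l, rfl⟩ := Nat.exists_eq_add_of_le hsf
  rw [Nat.add_sub_cancel_left]
  have htend := tendsto_pow_atTop_atTop_of_one_lt one_lt_one_add_rho
  rcases lt_trichotomy l B with hlB | hlB | hlB
  · -- the window is shorter than the block
    obtain ⟨m, rfl⟩ := Nat.exists_eq_add_of_lt hlB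
    have habs : |(l : ℝ) - ((l + m + 1 : ℕ) : ℝ)| = m + 1 := by
      push_cast
      rw [abs_sub_comm, abs_of_nonneg (by linarith [(Nat.cast_nonneg m : (0 : ℝ) ≤ m)])]
      ring
    rw [habs]
    have hm0 : (0 : ℝ) ≤ m := Nat.cast_nonneg _
    have hl0 : (0 : ℝ) ≤ l := Nat.cast_nonneg _
    -- End positions reach down only to about `ρB` above `s`; a shorter window is given up entirely,
    -- in favour of the degenerate one.
    by_cases hsmall : (l : ℝ) ≤ rho * ((l + m + 1 : ℕ) : ℝ)
    · refine ⟨s, le_rfl, by omega, Or.inr rfl, Or.inl ?_⟩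
      rw [Nat.add_sub_cancel_left]
      push_cast at hsmall
      rw [hrho'] at hsmall ⊢
      linarith
    · push Not at hsmall
      push_cast at hsmall
      -- The amount subtracted from `s + B` is the ceiling `c` of the power. Strictness gives `c ≥ m
      -- + 1`, hence `e ≤ f`; minimality gives `c ≤ m + 1 + ρm`.
      have hex : ∃ a : ℕ, (m : ℝ) < (1 + rho) ^ a := (htend.eventually_gt_atTop _).exists
      set a := Nat.find hex with ha
      have ha1 : (m : ℝ) < (1 + rho) ^ a := Nat.find_spec hex
      have hc : (⌈(1 + rho) ^ a⌉₊ : ℝ) ≤ m + 1 + rho * m ∧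
          (a : ℤ) ≤ ⌈Real.logb (1 + rho) (((l + m + 1 : ℕ) : ℝ) - rho * ((l + m + 1 : ℕ) : ℝ))⌉ := by
        have hlog : (m : ℝ) + 1 < ((l + m + 1 : ℕ) : ℝ) - rho * ((l + m + 1 : ℕ) : ℝ) := by
          push_cast
          linarith
        rcases Nat.eq_zero_or_pos a with h0 | h0
        · rw [h0]
          refine ⟨?_, ?_⟩
          · simp only [pow_zero, Nat.ceil_one, Nat.cast_one]
            nlinarith
          · have := Real.logb_nonneg one_lt_one_add_rho
              (x := ((l + m + 1 : ℕ) : ℝ) - rho * ((l + m + 1 : ℕ) : ℝ)) (by linarith)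
            exact_mod_cast Int.ceil_nonneg this
        · have hle : (1 + rho) ^ (a - 1) ≤ m :=
            not_lt.1 (Nat.find_min hex (m := a - 1) (by omega))
          have hpow : (1 + rho) ^ a = (1 + rho) * (1 + rho) ^ (a - 1) := by
            rw [← pow_succ', Nat.sub_add_cancel h0]
          have h1 : (1 + rho) ^ a ≤ (1 + rho) * m := by
            rw [hpow]
            exact mul_le_mul_of_nonneg_left hle (by linarith)
          refine ⟨?_, ?_⟩
          · have := Nat.ceil_lt_add_one (show 0 ≤ (1 + rho) ^ a by positivity)
            linarith
          · have h2 : ((a - 1 : ℕ) : ℝ) <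
                Real.logb (1 + rho) (((l + m + 1 : ℕ) : ℝ) - rho * ((l + m + 1 : ℕ) : ℝ)) := by
              rw [Real.lt_logb_iff_rpow_lt one_lt_one_add_rho (by linarith), Real.rpow_natCast]
              linarith
            have h3 : (((a - 1 : ℕ) : ℤ) : ℝ) < (⌈Real.logb (1 + rho)
                (((l + m + 1 : ℕ) : ℝ) - rho * ((l + m + 1 : ℕ) : ℝ))⌉ : ℤ) :=
              lt_of_lt_of_le (by exact_mod_cast h2) (Int.le_ceil _)
            have h4 := Int.cast_lt.1 h3
            omega
      obtain ⟨hc, halog⟩ := hc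
      set c := ⌈(1 + rho) ^ a⌉₊ with hcdef
      have hmc : m < c := Nat.lt_ceil.2 ha1
      have hcB : c ≤ l + m + 1 := by
        have : (c : ℝ) < ((l + m + 1 + 1 : ℕ) : ℝ) := by
          push_cast
          nlinarith
        have := Nat.cast_lt.1 this
        omega
      refine ⟨s + (l + m + 1) - c, by omega, by omega, Or.inl (Or.inr (Or.inr ⟨a, halog, ?_⟩)),
        Or.inl ?_⟩
      · have h1 : ⌊(s : ℝ) + ((l + m + 1 : ℕ) : ℝ) - (1 + rho) ^ a⌋ =
            ((s + (l + m + 1) : ℕ) : ℤ) - ⌈(1 + rho) ^ a⌉ := by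
          have : (s : ℝ) + ((l + m + 1 : ℕ) : ℝ) - (1 + rho) ^ a =
              (((s + (l + m + 1) : ℕ) : ℤ) : ℝ) + (-(1 + rho) ^ a) := by
            push_cast
            ring
          rw [this, Int.floor_intCast_add, Int.floor_neg]
          ring
        rw [h1, ← Int.natCast_ceil_eq_ceil (show 0 ≤ (1 + rho) ^ a by positivity), ← hcdef]
        omega
      · have h1 : (((s + l) - (s + (l + m + 1) - c) : ℕ) : ℝ) = c - (m + 1) := by
          have : (s + l) - (s + (l + m + 1) - c) = c - (m + 1) := by omega
          rw [this, Nat.cast_sub (by omega)]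
          push_cast
          ring
        rw [h1]
        nlinarith
  · refine ⟨s + l, by omega, le_rfl, Or.inl (Or.inl (by rw [hlB])), Or.inl ?_⟩
    rw [Nat.sub_self]
    simp only [Nat.cast_zero]
    positivity
  · -- the window is longer than the block
    obtain ⟨d, rfl⟩ := Nat.exists_eq_add_of_lt hlB
    have hd0 : (0 : ℝ) ≤ d := Nat.cast_nonneg _
    have hB0 : (0 : ℝ) ≤ B := Nat.cast_nonneg _
    have habs : |((B + d + 1 : ℕ) : ℝ) - B| = d + 1 := by
      push_cast
      rw [abs_of_nonneg (by linarith)]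
      ring
    rw [habs]
    -- When the excess dwarfs the block, losing the whole block is affordable; otherwise the cap `B
    -- / ρ` on the exponent is harmless.
    by_cases hbig : (B : ℝ) ≤ 2 * rho * (d + 1)
    · exact ⟨s + B, by omega, by omega, Or.inl (Or.inl rfl), Or.inr hbig⟩
    push Not at hbig
    have hN' := hN (by omega)
    have : s + (B + d + 1) - s - B = d + 1 := by omega
    rw [this] at hN'
    push_cast at hN'
    -- The exponent used is one less than the minimum: its power is below `d + 2`, so its floor is
    -- at most `d + 1`, and the shortfall is below `ρ(d + 2) ≤ 2ρ(d + 1)`.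
    have hex : ∃ a : ℕ, (d : ℝ) + 2 ≤ (1 + rho) ^ a := (htend.eventually_ge_atTop _).exists
    obtain ⟨a, ha⟩ : ∃ a, Nat.find hex = a + 1 := by
      refine Nat.exists_eq_succ_of_ne_zero fun h0 => ?_
      have := Nat.find_spec hex
      rw [h0, pow_zero] at this
      linarith
    have ha1 : (1 + rho) ^ a < d + 2 := not_le.1 (Nat.find_min hex (m := a) (by omega))
    have ha2 : (d : ℝ) + 2 ≤ (1 + rho) ^ a * (1 + rho) := by
      have := Nat.find_spec hex
      rwa [ha, pow_succ] at this
    have hc1 : (⌊(1 + rho) ^ a⌋₊ : ℝ) ≤ (1 + rho) ^ a := Nat.floor_le (by positivity)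
    have hc2 : (1 + rho) ^ a < ⌊(1 + rho) ^ a⌋₊ + 1 := Nat.lt_floor_add_one _
    set c := ⌊(1 + rho) ^ a⌋₊ with hcdef
    have hcd : c ≤ d + 1 := by
      have : (c : ℝ) < ((d + 2 : ℕ) : ℝ) := by
        push_cast
        linarith
      have := Nat.cast_lt.1 this
      omega
    refine ⟨s + B + c, by omega, by omega, Or.inl (Or.inr (Or.inl ⟨a, ?_, ?_⟩)), Or.inl ?_⟩
    · refine natCast_le_logb (le_min ?_ (by linarith))
      rw [le_div_iff₀ hrho]
      nlinarith
    · have h1 : (s : ℝ) + B + (1 + rho) ^ a = (((s + B : ℕ) : ℤ) : ℝ) + (1 + rho) ^ a := by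
        push_cast
        ring
      rw [h1, Int.floor_intCast_add,
        ← Int.natCast_floor_eq_floor (show 0 ≤ (1 + rho) ^ a by positivity), ← hcdef]
      push_cast
      ring
    · have h1 : ((s + (B + d + 1) - (s + B + c) : ℕ) : ℝ) = d + 1 - c := by
        have : s + (B + d + 1) - (s + B + c) = d + 1 - c := by omega
        rw [this, Nat.cast_sub hcd]
        push_cast
        ring
      rw [h1]
      nlinarith

/-! ### Images of positions under an alignment -/

/-- The first position of `p` that an alignment with matched symbols `A` assigns to the positions
from `t` onwards of `x`. -/
noncomputable def boundary (x p : Equiv.Perm (Fin n)) (A : Finset (Fin n)) (t : ℕ) : ℕ :=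
  sInf {q | q = n + 1 ∨ ∃ a ∈ A, t ≤ pos x a ∧ pos p a = q}

section Boundary

variable {x p : Equiv.Perm (Fin n)} {A : Finset (Fin n)}

theorem boundary_le (t : ℕ) : boundary x p A t ≤ n + 1 := Nat.sInf_le (Or.inl rfl)

theorem boundary_mem (t : ℕ) : boundary x p A t = n + 1 ∨
    ∃ a ∈ A, t ≤ pos x a ∧ pos p a = boundary x p A t :=
  Nat.sInf_mem (s := {q | q = n + 1 ∨ ∃ a ∈ A, t ≤ pos x a ∧ pos p a = q}) ⟨n + 1, Or.inl rfl⟩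

theorem one_le_boundary (t : ℕ) : 1 ≤ boundary x p A t := by
  rcases boundary_mem (x := x) (p := p) (A := A) t with h | ⟨a, -, -, h⟩
  · omega
  · rw [← h]
    exact one_le_pos p a

theorem boundary_mono : Monotone (boundary x p A) := by
  intro t t' h
  rcases boundary_mem (x := x) (p := p) (A := A) t' with h' | ⟨a, ha, hta, h'⟩
  · rw [h']
    exact boundary_le t
  · exact Nat.sInf_le (Or.inr ⟨a, ha, h.trans hta, h'⟩)

/-- Cutting `x` at `t` and `p` at the boundary splits the matched symbols in the same way. -/
theorem AgreeOn.pos_lt_iff (hA : AgreeOn x p A) {a : Fin n} (ha : a ∈ A) (t : ℕ) :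
    pos x a < t ↔ pos p a < boundary x p A t := by
  constructor
  · intro h
    rcases boundary_mem (x := x) (p := p) (A := A) t with h' | ⟨b, hb, htb, h'⟩
    · rw [h']
      exact pos_lt p a
    · rw [← h']
      exact hA a ha b hb (h.trans_le htb)
  · intro h
    by_contra! hcon
    exact absurd (Nat.sInf_le (Or.inr ⟨a, ha, hcon, rfl⟩)) h.not_ge

/-- Symbols of `p` between two boundaries are either matched into `[t, t')` of `x` or unmatched. The
next two lemmas count prefixes in the same way. -/
theorem AgreeOn.boundary_le_add (hA : AgreeOn x p A) {t t' : ℕ} (ht : 1 ≤ t) (htt' : t ≤ t')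
    (ht' : t' ≤ n + 1) :
    boundary x p A t' ≤ boundary x p A t + (t' - t) + (n - A.card) := by
  have h1 := card_pos_mem_Ico p (one_le_boundary (x := x) (p := p) (A := A) t)
    (boundary_le (x := x) (p := p) (A := A) t')
  have h2 := card_pos_mem_Ico x ht ht'
  have h3 : (Finset.univ.filter fun a => boundary x p A t ≤ pos p a ∧
      pos p a < boundary x p A t').card ≤
      (Finset.univ.filter fun a => t ≤ pos x a ∧ pos x a < t').card + Aᶜ.card := by
    refine (Finset.card_le_card ?_).trans (Finset.card_union_le _ _)
    intro a ha
    simp only [Finset.mem_filter, Finset.mem_univ, true_and, Finset.mem_union,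
      Finset.mem_compl] at ha ⊢
    by_cases haA : a ∈ A
    · rw [hA.pos_lt_iff haA, ← not_lt, hA.pos_lt_iff haA, not_lt]
      exact Or.inl ha
    · exact Or.inr haA
  have h4 := Finset.card_add_card_compl A
  rw [Fintype.card_fin] at h4
  omega

theorem AgreeOn.boundary_le_self_add (hA : AgreeOn x p A) {t : ℕ} (ht : 1 ≤ t)
    (ht' : t ≤ n + 1) : boundary x p A t ≤ t + (n - A.card) := by
  have h1 := card_pos_mem_Ico p le_rfl (boundary_le (x := x) (p := p) (A := A) t)
  have h2 := card_pos_mem_Ico x le_rfl ht'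
  have h3 : (Finset.univ.filter fun a => 1 ≤ pos p a ∧ pos p a < boundary x p A t).card ≤
      (Finset.univ.filter fun a => 1 ≤ pos x a ∧ pos x a < t).card + Aᶜ.card := by
    refine (Finset.card_le_card ?_).trans (Finset.card_union_le _ _)
    intro a ha
    simp only [Finset.mem_filter, Finset.mem_univ, true_and, Finset.mem_union,
      Finset.mem_compl] at ha ⊢
    by_cases haA : a ∈ A
    · rw [hA.pos_lt_iff haA]
      exact Or.inl ⟨one_le_pos x a, ha.2⟩
    · exact Or.inr haA
  have h4 := Finset.card_add_card_compl A
  rw [Fintype.card_fin] at h4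
  omega

theorem AgreeOn.le_boundary_add (hA : AgreeOn x p A) {t : ℕ} (ht' : t ≤ n + 1) :
    t ≤ boundary x p A t + (n - A.card) := by
  have h1 := card_pos_mem_Ico p le_rfl (boundary_le (x := x) (p := p) (A := A) t)
  have h2 := card_pos_mem_Ico x le_rfl ht'
  have h3 : (Finset.univ.filter fun a => 1 ≤ pos x a ∧ pos x a < t).card ≤
      (Finset.univ.filter fun a => 1 ≤ pos p a ∧ pos p a < boundary x p A t).card + Aᶜ.card := by
    refine (Finset.card_le_card ?_).trans (Finset.card_union_le _ _)
    intro a ha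
    simp only [Finset.mem_filter, Finset.mem_univ, true_and, Finset.mem_union,
      Finset.mem_compl] at ha ⊢
    by_cases haA : a ∈ A
    · rw [← hA.pos_lt_iff haA]
      exact Or.inl ⟨one_le_pos p a, ha.2⟩
    · exact Or.inr haA
  have h4 := Finset.card_add_card_compl A
  have := one_le_boundary (x := x) (p := p) (A := A) t
  rw [Fintype.card_fin] at h4
  omega

end Boundary

/-! ### Rounding -/

/-- The largest positive multiple of `g` up to `s`, or `g` if there is none. -/
def roundTo (g s : ℕ) : ℕ := max g (g * (s / g))

theorem dvd_roundTo (g s : ℕ) : g ∣ roundTo g s := by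
  unfold roundTo
  rcases max_choice g (g * (s / g)) with h | h <;> rw [h]
  exact dvd_mul_right _ _

theorem roundTo_mono (g : ℕ) : Monotone (roundTo g) := fun s t h => by
  unfold roundTo
  gcongr

theorem roundTo_le {g s : ℕ} (hs : 1 ≤ s) : roundTo g s ≤ s + (g - 1) := by
  have := Nat.mul_div_le s g
  exact max_le (by omega) (by omega)

theorem le_roundTo_add {g : ℕ} (hg : 1 ≤ g) (s : ℕ) : s ≤ roundTo g s + (g - 1) := by
  have h1 := Nat.lt_mul_div_succ s hg
  rw [mul_add, mul_one] at h1
  have h2 : g * (s / g) ≤ roundTo g s := le_max_right _ _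
  omega

theorem le_roundTo (g s : ℕ) : g ≤ roundTo g s := le_max_left _ _

theorem roundTo_le_of_le {g s m : ℕ} (hg : g ≤ m) (hs : s ≤ m) : roundTo g s ≤ m :=
  max_le hg ((Nat.mul_div_le s g).trans hs)

/-! ### Windows that follow an alignment -/

theorem card_blockIndex_eq (hn : 0 < n) {K : ℕ} (hK : 0 < K) (x : Equiv.Perm (Fin n)) {j : ℕ}
    (hj : j < K) :
    (Finset.univ.filter fun a => blockIndex n K (pos x a) = j).card = blockSize n K j := by
  rw [blockSize, ← card_pos_mem_Ico x (one_le_blockStart n K j) (blockStart_le n hK hj)]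
  congr 1
  ext a
  simp only [Finset.mem_filter, Finset.mem_univ, true_and,
    blockIndex_eq_iff hn hK (one_le_pos x a)]

theorem card_filter_eq_sum_blockIndex (hn : 0 < n) {K : ℕ} (hK : 0 < K)
    (x : Equiv.Perm (Fin n)) (A : Finset (Fin n)) :
    A.card = ∑ j ∈ Finset.range K, (A.filter fun a => blockIndex n K (pos x a) = j).card :=
  Finset.card_eq_sum_card_fiberwise fun a _ =>
    Finset.mem_coe.2 (Finset.mem_range.2 (blockIndex_lt hn hK (one_le_pos x a) (pos_lt x a)))

/-- Windows close to the images of the blocks under an alignment of `x` and `p`. -/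
theorem exists_windows (hn : 0 < n) {ε : ℝ} (hε : 0 ≤ ε) {x p : Equiv.Perm (Fin n)}
    {A : Finset (Fin n)} (hA : AgreeOn x p A) :
    ∃ s e : ℕ → ℕ, Monotone s ∧ (∀ j, 1 ≤ s j) ∧ (∀ j, s j ≤ n + 1) ∧
      (∀ j < numBlocks n ε, s j ≤ e j ∧ e j ≤ s (j + 1)) ∧
      (∀ j < numBlocks n ε, (s j, e j) ∈ windows n ε j ∨
        s j = e j ∧ (s j, e j) ∈ emptyWindows n ε j) ∧
      ((A.filter fun a => ¬ (s (blockIndex n (numBlocks n ε) (pos x a)) ≤ pos p a ∧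
        pos p a < e (blockIndex n (numBlocks n ε) (pos x a)))).card : ℝ) ≤
        7 * rho * (2 * (n - A.card)) := by
  have hrho := rho_pos
  have hrho' : rho = 0.000001 := rfl
  have hK := numBlocks_pos hn hε
  have hAn : A.card ≤ n := by simpa using A.card_le_univ
  obtain ⟨k, hk, hstart, hend, hloss, hgn⟩ := exists_scale hn hε (h := n - A.card) (Nat.sub_le _ _)
  have hg := one_le_gap n ε k
  set K := numBlocks n ε with hKdef
  set g := gap n ε k with hgdef
  have hK1 : (1 : ℝ) ≤ K := by exact_mod_cast hK
  let σ : ℕ → ℕ := fun j => boundary x p A (blockStart n K j)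
  -- One scale serves all blocks of a permutation, so rounding is monotone and consecutive windows
  -- stay disjoint.
  let s : ℕ → ℕ := fun j => roundTo g (σ j)
  have hs1 : ∀ j, 1 ≤ s j := fun j => hg.trans (le_roundTo g _)
  have hsn : ∀ j, s j ≤ n + 1 := fun j => roundTo_le_of_le hgn (boundary_le _)
  have hσs : ∀ j, σ j ≤ s j + (g - 1) := fun j => le_roundTo_add hg _
  have hsσ : ∀ j, s j ≤ σ j + (g - 1) := fun j => roundTo_le (one_le_boundary _)
  have hsmono : Monotone s := (roundTo_mono g).comp (boundary_mono.comp (blockStart_mono n K))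
  have hisStart : ∀ j ≤ K, IsStart n ε j k (s j) := by
    intro j hj
    have h1 := hA.boundary_le_self_add (one_le_blockStart n K j) (blockStart_le n hK hj)
    have h2 := hA.le_boundary_add (blockStart_le n hK hj)
    have h3 : s j ≤ blockStart n K j + ((n - A.card) + (g - 1)) := by
      have := hsσ j
      simp only [σ] at this
      omega
    have h4 : blockStart n K j ≤ s j + ((n - A.card) + (g - 1)) := by
      have := hσs j
      simp only [σ] at this
      omega
    have h3' : (s j : ℝ) ≤ blockStart n K j + (((n - A.card : ℕ) : ℝ) + (g - 1 : ℕ)) := by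
      exact_mod_cast h3
    have h4' : (blockStart n K j : ℝ) ≤ s j + (((n - A.card : ℕ) : ℝ) + (g - 1 : ℕ)) := by
      exact_mod_cast h4
    exact ⟨by linarith, by linarith, dvd_roundTo g _⟩
  have hlen : ∀ j < K, s (j + 1) ≤ s j + blockSize n K j + ((n - A.card) + 2 * (g - 1)) := by
    intro j hj
    have h1 := hA.boundary_le_add (one_le_blockStart n K j)
      (blockStart_mono n K j.le_succ) (blockStart_le n hK hj)
    have h2 := hsσ (j + 1)
    have h3 := hσs j
    simp only [σ] at h2 h3
    unfold blockSize
    simp only [Nat.succ_eq_add_one] at h1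
    omega
  have hends : ∀ j, ∃ e, j < K → s j ≤ e ∧ e ≤ s (j + 1) ∧
      (IsEnd (blockSize n K j) k (s j) e ∨ s j = e) ∧
      (((s (j + 1) - e : ℕ) : ℝ) ≤
          2 * rho * |((s (j + 1) - s j : ℕ) : ℝ) - blockSize n K j| ∨
        (blockSize n K j : ℝ) ≤
          2 * rho * |((s (j + 1) - s j : ℕ) : ℝ) - blockSize n K j|) := by
    intro j
    by_cases hj : j < K
    · obtain ⟨e, he⟩ := exists_end (B := blockSize n K j) (k := k) (hsmono j.le_succ) (by
        intro hlt
        have h1 := hlen j hj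
        simp only [Nat.succ_eq_add_one] at hlt ⊢
        -- If everything is matched, the rounding bound forces `g = 1`, and no interval can exceed
        -- its block.
        have hpos : 0 < n - A.card := by
          by_contra hcon
          have h0 : n - A.card = 0 := by omega
          rw [h0] at hloss
          have h2 : ((g - 1 : ℕ) : ℝ) ≤ 0 := by
            have h5 : (0 : ℝ) ≤ ((g - 1 : ℕ) : ℝ) := Nat.cast_nonneg _
            simp only [Nat.cast_zero, mul_zero] at hloss
            nlinarith
          have h3 : g - 1 = 0 := by exact_mod_cast le_antisymm h2 (Nat.cast_nonneg _)
          omega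
        refine le_trans ?_ (hend hpos)
        have h4 : s (j + 1) - s j - blockSize n K j ≤ (n - A.card) + 2 * (g - 1) := by omega
        have h5 : ((s (j + 1) - s j - blockSize n K j : ℕ) : ℝ) ≤
            ((n - A.card : ℕ) : ℝ) + 2 * ((g - 1 : ℕ) : ℝ) := by exact_mod_cast h4
        linarith)
      exact ⟨e, fun _ => he⟩
    · exact ⟨0, fun h => absurd h hj⟩
  choose e he using hends
  refine ⟨s, e, hsmono, hs1, hsn, fun j hj => ⟨(he j hj).1, (he j hj).2.1⟩, ?_, ?_⟩
  · intro j hj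
    obtain ⟨h1, h2, h3, -⟩ := he j hj
    have hle := h2.trans (hsn (j + 1))
    rcases h3 with h3 | h3
    · exact Or.inl ⟨hs1 j, h1, hle, k, hk, hisStart j hj.le, h3⟩
    · exact Or.inr ⟨h3, hs1 j, h3, hle, k, hk, hisStart j hj.le⟩
  · -- counting the lost symbols block by block
    let lost : Finset (Fin n) := A.filter fun a => ¬ (s (blockIndex n K (pos x a)) ≤ pos p a ∧
      pos p a < e (blockIndex n K (pos x a)))
    let Aj : ℕ → Finset (Fin n) := fun j => A.filter fun a => blockIndex n K (pos x a) = j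
    have hrange : ∀ j, ∀ a ∈ A, blockIndex n K (pos x a) = j →
        σ j ≤ pos p a ∧ pos p a < σ (j + 1) := by
      intro j a ha haj
      rw [blockIndex_eq_iff hn hK (one_le_pos x a)] at haj
      exact ⟨not_lt.1 fun h => absurd ((hA.pos_lt_iff ha _).2 h) haj.1.not_gt,
        (hA.pos_lt_iff ha _).1 haj.2⟩
    have hAjB : ∀ j < K, (Aj j).card ≤ blockSize n K j := by
      intro j hj
      rw [← card_blockIndex_eq hn hK x hj]
      exact Finset.card_le_card (Finset.filter_subset_filter _ (Finset.subset_univ _))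
    have hAjl : ∀ j < K, (Aj j).card ≤ (s (j + 1) - s j) + 2 * (g - 1) := by
      intro j hj
      have h1 : (Aj j).card ≤
          (Finset.univ.filter fun a => σ j ≤ pos p a ∧ pos p a < σ (j + 1)).card := by
        refine Finset.card_le_card fun a ha => ?_
        rw [Finset.mem_filter] at ha
        simpa using hrange j a ha.1 ha.2
      rw [card_pos_mem_Ico p (one_le_boundary _) (boundary_le _)] at h1
      have h2 := hσs (j + 1)
      have h3 := hsσ j
      simp only [σ] at h2 h3
      omega
    -- `Aj j` embeds both in the block and, up to rounding, in the interval. Summed over `j`, the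
    -- right side is at most `2(n - |A|)` plus rounding.
    have habs : ∀ j < K, |((s (j + 1) - s j : ℕ) : ℝ) - blockSize n K j| ≤
        ((s (j + 1) - s j : ℕ) : ℝ) + blockSize n K j - 2 * (Aj j).card +
          4 * ((g - 1 : ℕ) : ℝ) := by
      intro j hj
      have h1 : ((Aj j).card : ℝ) ≤ blockSize n K j := by exact_mod_cast hAjB j hj
      have h2 : ((Aj j).card : ℝ) ≤ ((s (j + 1) - s j : ℕ) : ℝ) + 2 * ((g - 1 : ℕ) : ℝ) := by
        exact_mod_cast hAjl j hj
      have h3 : (0 : ℝ) ≤ ((g - 1 : ℕ) : ℝ) := Nat.cast_nonneg _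
      rw [abs_le]
      constructor <;> linarith
    have hlost : ∀ j < K, ((lost.filter fun a => blockIndex n K (pos x a) = j).card : ℝ) ≤
        2 * ((g - 1 : ℕ) : ℝ) +
          2 * rho * |((s (j + 1) - s j : ℕ) : ℝ) - blockSize n K j| := by
      intro j hj
      obtain ⟨h1, h2, -, h4⟩ := he j hj
      let U1 : Finset (Fin n) := Finset.univ.filter fun a => σ j ≤ pos p a ∧ pos p a < s j
      let U2 : Finset (Fin n) :=
        Finset.univ.filter fun a => s (j + 1) ≤ pos p a ∧ pos p a < σ (j + 1)
      let U3 : Finset (Fin n) := Finset.univ.filter fun a =>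
        blockIndex n K (pos x a) = j ∧ e j ≤ pos p a ∧ pos p a < s (j + 1)
      -- A matched symbol is lost by rounding the start up, by rounding the next start down, or by
      -- the choice of the end.
      have hsub : (lost.filter fun a => blockIndex n K (pos x a) = j) ⊆ U1 ∪ U2 ∪ U3 := by
        intro a ha
        simp only [lost, Finset.mem_filter] at ha
        obtain ⟨⟨haA, hw⟩, haj⟩ := ha
        rw [haj] at hw
        have := hrange j a haA haj
        simp only [U1, U2, U3, Finset.mem_union, Finset.mem_filter, Finset.mem_univ, true_and]
        omega
      have hU1 : U1.card ≤ g - 1 := by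
        simp only [U1]
        rw [card_pos_mem_Ico p (one_le_boundary _) (hsn j)]
        have := hsσ j
        simp only [σ] at this
        omega
      have hU2 : U2.card ≤ g - 1 := by
        simp only [U2]
        rw [card_pos_mem_Ico p (hs1 _) (boundary_le _)]
        have := hσs (j + 1)
        simp only [σ] at this
        omega
      have hU3 : (U3.card : ℝ) ≤ 2 * rho * |((s (j + 1) - s j : ℕ) : ℝ) - blockSize n K j| := by
        rcases h4 with h4 | h4
        · refine le_trans ?_ h4
          rw [← card_pos_mem_Ico p ((hs1 j).trans h1) (hsn (j + 1))]
          refine Nat.cast_le.2 (Finset.card_le_card fun a => ?_)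
          simp only [U3, Finset.mem_filter, Finset.mem_univ, true_and]
          exact fun h => h.2
        · refine le_trans ?_ h4
          rw [← card_blockIndex_eq hn hK x hj]
          refine Nat.cast_le.2 (Finset.card_le_card fun a => ?_)
          simp only [U3, Finset.mem_filter, Finset.mem_univ, true_and]
          exact fun h => h.1
      have h5 := Finset.card_le_card hsub
      have h6 := Finset.card_union_le (U1 ∪ U2) U3
      have h7 := Finset.card_union_le U1 U2
      have h8 : (lost.filter fun a => blockIndex n K (pos x a) = j).card ≤
          2 * (g - 1) + U3.card := by omega
      have h9 : ((lost.filter fun a => blockIndex n K (pos x a) = j).card : ℝ) ≤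
          2 * ((g - 1 : ℕ) : ℝ) + U3.card := by exact_mod_cast h8
      linarith
    have htotal : (lost.card : ℝ) ≤ ∑ j ∈ Finset.range K, (2 * ((g - 1 : ℕ) : ℝ) + 2 * rho *
        (((s (j + 1) - s j : ℕ) : ℝ) + blockSize n K j - 2 * (Aj j).card +
          4 * ((g - 1 : ℕ) : ℝ))) := by
      rw [card_filter_eq_sum_blockIndex hn hK x lost]
      push_cast
      refine Finset.sum_le_sum fun j hj => ?_
      rw [Finset.mem_range] at hj
      exact (hlost j hj).trans (by
        have := mul_le_mul_of_nonneg_left (habs j hj) (show 0 ≤ 2 * rho by linarith)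
        linarith)
    have hsum1 : ∑ j ∈ Finset.range K, ((s (j + 1) - s j : ℕ) : ℝ) ≤ n := by
      have h1 : ∑ j ∈ Finset.range K, (s (j + 1) - s j) ≤ n := by
        rw [Finset.sum_range_tsub hsmono]
        have := hsn K
        have := hs1 0
        omega
      exact_mod_cast h1
    have hsum2 : ∑ j ∈ Finset.range K, (blockSize n K j : ℝ) = n := by
      exact_mod_cast sum_blockSize n hK
    have hsum3 : ∑ j ∈ Finset.range K, ((Aj j).card : ℝ) = A.card := by
      rw [card_filter_eq_sum_blockIndex hn hK x A]
      push_cast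
      rfl
    simp only [Finset.sum_add_distrib, ← Finset.mul_sum, Finset.sum_sub_distrib, hsum2, hsum3,
      Finset.sum_const, Finset.card_range, nsmul_eq_mul] at htotal
    have hh : ((n - A.card : ℕ) : ℝ) = n - A.card := Nat.cast_sub hAn
    rw [hh] at hloss
    have hh0 : (0 : ℝ) ≤ n - A.card := by rw [← hh]; exact Nat.cast_nonneg _
    -- With `h = n - |A|` and `2K(g - 1) ≤ 5ρh`, the total is at most `5ρh + 2ρ(2h + 10ρh)`, which
    -- is below `14ρh`.
    refine htotal.trans ?_
    have h1 := mul_le_mul_of_nonneg_left hsum1 (show 0 ≤ 2 * rho by linarith)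
    rw [hrho'] at hloss h1 ⊢
    nlinarith

/-! ### Postprocessing -/

section Dummies

variable {α : Type*}

theorem length_reduceOption_add_count [DecidableEq α] (l : List (Option α)) :
    l.reduceOption.length + l.count none = l.length := by
  induction l with
  | nil => rfl
  | cons a l ih =>
    cases a with
    | none =>
      rw [List.reduceOption_cons_of_none, List.count_cons_self, List.length_cons]
      omega
    | some a =>
      rw [List.reduceOption_cons_of_some, List.count_cons_of_ne (by simp), List.length_cons,
        List.length_cons]
      omega

theorem reduceOption_dropDummies (m : ℕ) (l : List (Option α)) :
    (dropDummies m l).reduceOption = l.reduceOption := by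
  induction l generalizing m with
  | nil => cases m <;> rfl
  | cons a l ih =>
    cases m with
    | zero => rfl
    | succ m =>
      cases a with
      | none => simp only [dropDummies, ih, List.reduceOption_cons_of_none]
      | some a => simp only [dropDummies, ih, List.reduceOption_cons_of_some]

theorem length_dropDummies_add [DecidableEq α] {m : ℕ} {l : List (Option α)}
    (h : m ≤ l.count none) : (dropDummies m l).length + m = l.length := by
  induction l generalizing m with
  | nil =>
    simp only [List.count_nil, Nat.le_zero] at h
    subst h
    rfl
  | cons a l ih =>
    cases m with
    | zero => rfl
    | succ m =>
      cases a with
      | none =>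
        rw [List.count_cons_self] at h
        have := ih (m := m) (by omega)
        simp only [dropDummies, List.length_cons]
        omega
      | some a =>
        rw [List.count_cons_of_ne (by simp)] at h
        have := ih h
        simp only [dropDummies, List.length_cons]
        omega

theorem fillDummies_perm [DecidableEq α] {l : List (Option α)} {us : List α}
    (h : l.count none = us.length) : (fillDummies l us).Perm (l.reduceOption ++ us) := by
  induction l generalizing us with
  | nil =>
    rw [List.count_nil] at h
    rw [List.length_eq_zero_iff.1 h.symm]
    rfl
  | cons a l ih =>
    cases a with
    | some a =>
      rw [List.count_cons_of_ne (by simp)] at h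
      simp only [fillDummies, List.reduceOption_cons_of_some, List.cons_append]
      exact (ih h).cons a
    | none =>
      rw [List.count_cons_self] at h
      cases us with
      | nil => simp at h
      | cons u us =>
        simp only [fillDummies, List.reduceOption_cons_of_none]
        exact ((ih (by simpa using h)).cons u).trans List.perm_middle.symm

theorem reduceOption_sublist_fillDummies (l : List (Option α)) (us : List α) :
    l.reduceOption.Sublist (fillDummies l us) := by
  induction l generalizing us with
  | nil => exact List.nil_sublist _
  | cons a l ih =>
    cases a with
    | some a =>
      simp only [fillDummies, List.reduceOption_cons_of_some]
      exact (ih us).cons_cons a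
    | none =>
      cases us with
      | nil =>
        simp only [fillDummies, List.reduceOption_cons_of_none]
        exact ih []
      | cons u us =>
        simp only [fillDummies, List.reduceOption_cons_of_none]
        exact (ih us).cons u

theorem reduceOption_map_some (t : List α) : (t.map some).reduceOption = t := by
  induction t with
  | nil => rfl
  | cons a t ih => rw [List.map_cons, List.reduceOption_cons_of_some, ih]

end Dummies

/-- At most `n` entries are real symbols, so there are enough dummies to delete, and those left are
as many as the unused symbols. -/
theorem exists_postProcess_eq_str {z : List (Option (Fin n))} (hz : z.reduceOption.Nodup)
    (hlen : n ≤ z.length) :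
    ∃ y : Equiv.Perm (Fin n), postProcess z = str y ∧ z.reduceOption.Sublist (str y) := by
  have h1 := length_reduceOption_add_count z
  have h2 : z.reduceOption.length ≤ n := by simpa using hz.length_le_card
  have h3 := length_dropDummies_add (m := z.length - n) (l := z) (by omega)
  have h4 := reduceOption_dropDummies (z.length - n) z
  set d := dropDummies (z.length - n) z with hd
  have h5 := length_reduceOption_add_count d
  have hmem : ∀ a, a ∈ unused d ↔ a ∉ d.reduceOption := by
    intro a
    simp [unused, List.reduceOption_mem_iff]
  have hun : (unused d).Nodup := Finset.sort_nodup _ _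
  have h6 : (unused d).length + d.reduceOption.length = n := by
    rw [← List.toFinset_card_of_nodup hun, ← List.toFinset_card_of_nodup (h4 ▸ hz)]
    have : (unused d).toFinset = d.reduceOption.toFinsetᶜ := by
      ext a
      simp only [List.mem_toFinset, Finset.mem_compl, hmem]
    rw [this, add_comm, Finset.card_add_card_compl, Fintype.card_fin]
  have hperm := fillDummies_perm (l := d) (us := unused d) (by omega)
  have hnodup : (fillDummies d (unused d)).Nodup := by
    rw [hperm.nodup_iff, List.nodup_append]
    refine ⟨h4 ▸ hz, hun, ?_⟩
    rintro a ha b hb rfl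
    exact (hmem a).1 hb ha
  obtain ⟨y, hy⟩ := exists_str_eq hnodup (by rw [hperm.length_eq, List.length_append]; omega)
  refine ⟨y, hy, ?_⟩
  rw [← hy, ← h4]
  exact reduceOption_sublist_fillDummies _ _

/-- Dummies never take part in a common subsequence with an input; replacing them keeps every common
subsequence and does not increase the length. -/
theorem ed_str_le_ed_of_reduceOption_sublist {z : List (Option (Fin n))}
    {y : Equiv.Perm (Fin n)} (hlen : n ≤ z.length) (hy : z.reduceOption.Sublist (str y))
    (p : Equiv.Perm (Fin n)) : ed (str y) (str p) ≤ ed z ((str p).map some) := by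
  obtain ⟨w, hw, hwp, h⟩ := exists_ed_add_two_mul_length_eq z ((str p).map some)
  obtain ⟨v, hv, rfl⟩ := List.sublist_map_iff.1 hwp
  have h1 : v.Sublist z.reduceOption := by
    have := hw.filterMap id
    rwa [show List.filterMap id (v.map some) = v from reduceOption_map_some v] at this
  have h2 := ed_add_two_mul_length_le (h1.trans hy) hv
  simp only [List.length_map, length_str] at h h2
  omega

/-! ### Block composition -/

/-- Sequences of groups for blocks with index at least `p`, whose windows start after the given
positions. -/
def ValidFrom (n : ℕ) (ε : ℝ) : ℕ → (Fin 5 → ℕ) → List (ℕ × Group) → Prop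
  | p, _, [] => p ≤ numBlocks n ε
  | p, v, (j, w) :: q => p ≤ j ∧ j < numBlocks n ε ∧ w ∈ groups n ε j ∧ (∀ i, v i ≤ (w i).1) ∧
      ValidFrom n ε (j + 1) (fun i => (w i).2) q

theorem groups_bounds {ε : ℝ} {j : ℕ} {w : Group} (hw : w ∈ groups n ε j) (i : Fin 5) :
    1 ≤ (w i).1 ∧ (w i).1 ≤ (w i).2 ∧ (w i).2 ≤ n + 1 := by
  rcases hw with hw | ⟨i₀, ⟨h, -, he⟩, hw⟩
  · exact ⟨(hw i).1, (hw i).2.1, (hw i).2.2.1⟩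
  · by_cases hi : i = i₀
    · subst hi
      exact ⟨he.1, he.2.1.le, he.2.2.1⟩
    · exact ⟨(hw i hi).1, (hw i hi).2.1, (hw i hi).2.2.1⟩

theorem validFrom_of_isChain {ε : ℝ} {q : List (ℕ × Group)} {p : ℕ} {v : Fin 5 → ℕ}
    (hp : p ≤ numBlocks n ε) (hmem : ∀ a ∈ q, a.1 < numBlocks n ε ∧ a.2 ∈ groups n ε a.1)
    (hchain : q.IsChain fun a b => a.1 < b.1 ∧ ∀ i, (a.2 i).2 ≤ (b.2 i).1)
    (hhead : ∀ a ∈ q.head?, p ≤ a.1 ∧ ∀ i, v i ≤ (a.2 i).1) : ValidFrom n ε p v q := by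
  induction q generalizing p v with
  | nil => exact hp
  | cons a q ih =>
    obtain ⟨j, w⟩ := a
    have ha := hmem (j, w) (by simp)
    have hh := hhead (j, w) (by simp)
    refine ⟨hh.1, ha.1, ha.2, hh.2, ih (Nat.succ_le_of_lt ha.1)
      (fun b hb => hmem b (List.mem_cons_of_mem _ hb)) hchain.tail ?_⟩
    intro b hb
    cases q with
    | nil => simp at hb
    | cons c q =>
      simp only [List.head?_cons, Option.mem_some_iff] at hb
      subst hb
      have := (List.isChain_cons_cons.1 hchain).1
      exact ⟨this.1, this.2⟩

theorem IsValid.validFrom {ε : ℝ} {q : List (ℕ × Group)} (hq : IsValid n ε q) :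
    ValidFrom n ε 0 (fun _ => 1) q := by
  refine validFrom_of_isChain (Nat.zero_le _) hq.2.1 hq.2.2 fun a ha => ⟨Nat.zero_le _, fun i => ?_⟩
  exact (groups_bounds (hq.2.1 a (List.mem_of_mem_head? ha)).2 i).1

theorem ValidFrom.isChain {ε : ℝ} {q : List (ℕ × Group)} {p : ℕ} {v : Fin 5 → ℕ}
    (h : ValidFrom n ε p v q) :
    (∀ a ∈ q, a.1 < numBlocks n ε ∧ a.2 ∈ groups n ε a.1) ∧
      q.IsChain fun a b => a.1 < b.1 ∧ ∀ i, (a.2 i).2 ≤ (b.2 i).1 := by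
  induction q generalizing p v with
  | nil => exact ⟨by simp, List.isChain_nil⟩
  | cons a q ih =>
    obtain ⟨j, w⟩ := a
    obtain ⟨-, hj, hw, -, hq⟩ := h
    obtain ⟨h1, h2⟩ := ih hq
    refine ⟨?_, ?_⟩
    · intro b hb
      rcases List.mem_cons.1 hb with rfl | hb
      · exact ⟨hj, hw⟩
      · exact h1 b hb
    · cases q with
      | nil => exact List.isChain_singleton _
      | cons c q =>
        obtain ⟨hc, -, -, hcv, -⟩ := hq
        exact List.isChain_cons_cons.2 ⟨⟨hc, hcv⟩, h2⟩

theorem ValidFrom.isValid {ε : ℝ} {q : List (ℕ × Group)} {p : ℕ} {v : Fin 5 → ℕ}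
    (h : ValidFrom n ε p v q) (hq : q ≠ []) : IsValid n ε q :=
  ⟨hq, h.isChain.1, h.isChain.2⟩

theorem drop_eq_take_append_drop {α : Type*} (l : List α) {a b : ℕ} (h : a ≤ b) :
    l.drop a = (l.drop a).take (b - a) ++ l.drop b := by
  conv_lhs => rw [← List.take_append_drop (b - a) (l.drop a)]
  rw [List.drop_drop, Nat.add_sub_cancel' h]

/-- `ed` is subadditive under concatenation; the sequence cuts both strings into matching pieces,
with dummies and gaps bounded by their lengths. -/
theorem sum_ed_inducedFrom_le {ε : ℝ} (π : Fin 5 → Equiv.Perm (Fin n))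
    (R : ℕ → Group → List (Option (Fin n))) {q : List (ℕ × Group)} {p : ℕ} {v : Fin 5 → ℕ}
    (hq : ValidFrom n ε p v q) (hv : ∀ i, 1 ≤ v i) :
    ∑ i, ed (inducedFrom (numBlocks n ε) R p q) (((str (π i)).drop (v i - 1)).map some) ≤
      alignCostFrom (numBlocks n ε) π R p v q := by
  induction q generalizing p v with
  | nil =>
    refine Finset.sum_le_sum fun i _ => ?_
    refine (ed_le_length_add_length _ _).trans ?_
    have := hv i
    simp only [inducedFrom, List.length_replicate, List.length_map, List.length_drop, length_str]
    omega
  | cons a q ih =>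
    obtain ⟨j, w⟩ := a
    obtain ⟨-, -, hw, hvw, hq⟩ := hq
    have hb := groups_bounds hw
    have ih' := ih hq fun i => (hb i).1.trans (hb i).2.1
    simp only [inducedFrom, alignCostFrom]
    refine le_trans ?_ (Nat.add_le_add_left ih' _)
    rw [← Finset.sum_add_distrib, ← Finset.sum_add_distrib]
    refine Finset.sum_le_sum fun i _ => ?_
    have h1 := hv i
    have h2 := hvw i
    obtain ⟨h3, h4, h5⟩ := hb i
    have e1 : (str (π i)).drop (v i - 1) = ((str (π i)).drop (v i - 1)).take ((w i).1 - v i) ++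
        (substr (π i) (w i) ++ (str (π i)).drop ((w i).2 - 1)) := by
      rw [drop_eq_take_append_drop (str (π i)) (show v i - 1 ≤ (w i).1 - 1 by omega),
        drop_eq_take_append_drop (str (π i)) (show (w i).1 - 1 ≤ (w i).2 - 1 by omega),
        show (w i).1 - 1 - (v i - 1) = (w i).1 - v i by omega,
        show (w i).2 - 1 - ((w i).1 - 1) = (w i).2 - (w i).1 by omega, substr]
      congr 1
      rw [List.take_append_of_le_length]
      · rw [List.take_take, min_self]
      · simp only [List.length_take, List.length_drop, length_str]
        omega
    rw [e1, List.map_append, List.map_append, List.append_assoc]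
    refine (ed_append_le _ _ _ _).trans ?_
    have e2 := ed_append_le (R j w) (inducedFrom (numBlocks n ε) R (j + 1) q)
      ((substr (π i) (w i)).map some) (((str (π i)).drop ((w i).2 - 1)).map some)
    have e3 := ed_le_length_add_length
      (List.replicate (blocksLength n (numBlocks n ε) p j) (none : Option (Fin n)))
      ((((str (π i)).drop (v i - 1)).take ((w i).1 - v i)).map some)
    simp only [List.length_replicate, List.length_map, List.length_take] at e3
    omega

theorem blocksLength_split (n K : ℕ) {p j : ℕ} (hp : p ≤ j) (hj : j < K) :
    blocksLength n K p K =
      blocksLength n K p j + blockSize n K j + blocksLength n K (j + 1) K := by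
  unfold blocksLength
  rw [← Finset.sum_Ico_consecutive _ hp hj.le, Finset.sum_eq_sum_Ico_succ_bot hj, add_assoc]

theorem blocksLength_le_length_inducedFrom {ε : ℝ} {π : Fin 5 → Equiv.Perm (Fin n)}
    {R : ℕ → Group → List (Option (Fin n))} (hR : IsCandidates ε π R) {q : List (ℕ × Group)}
    {p : ℕ} {v : Fin 5 → ℕ} (hq : ValidFrom n ε p v q) :
    blocksLength n (numBlocks n ε) p (numBlocks n ε) ≤
      (inducedFrom (numBlocks n ε) R p q).length := by
  induction q generalizing p v with
  | nil => simp [inducedFrom]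
  | cons a q ih =>
    obtain ⟨j, w⟩ := a
    obtain ⟨hpj, hj, hw, -, hq⟩ := hq
    have h1 := ih hq
    obtain ⟨t, -, -, ht⟩ := (hR j hj w hw).exists_list
    rw [blocksLength_split n _ hpj hj]
    simp only [inducedFrom, List.length_append, List.length_replicate, ht, List.length_map]
    omega

/-- A symbol of a candidate occurs in four of its five windows. Windows of later groups lie further
right, so a repetition would need `4 + 4 ≤ 5`. The second conjunct carries the induction. -/
theorem nodup_reduceOption_inducedFrom {ε : ℝ} {π : Fin 5 → Equiv.Perm (Fin n)}
    {R : ℕ → Group → List (Option (Fin n))} (hR : IsCandidates ε π R) {q : List (ℕ × Group)}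
    {p : ℕ} {v : Fin 5 → ℕ} (hq : ValidFrom n ε p v q) :
    (inducedFrom (numBlocks n ε) R p q).reduceOption.Nodup ∧
      ∀ a ∈ (inducedFrom (numBlocks n ε) R p q).reduceOption,
        4 ≤ (Finset.univ.filter fun i => v i ≤ pos (π i) a).card := by
  induction q generalizing p v with
  | nil => simp [inducedFrom]
  | cons a q ih =>
    obtain ⟨j, w⟩ := a
    obtain ⟨hpj, hj, hw, hvw, hq⟩ := hq
    obtain ⟨h1, h2⟩ := ih hq
    have hb := groups_bounds hw
    obtain ⟨t, htn, htv, ht⟩ := (hR j hj w hw).exists_list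
    have hred : (inducedFrom (numBlocks n ε) R p ((j, w) :: q)).reduceOption =
        t ++ (inducedFrom (numBlocks n ε) R (j + 1) q).reduceOption := by
      simp only [inducedFrom, ht, List.reduceOption_append, List.reduceOption_replicate_none,
        reduceOption_map_some, List.nil_append, List.append_nil]
    have htcount : ∀ a ∈ t, 4 ≤ (Finset.univ.filter fun i =>
        (w i).1 ≤ pos (π i) a ∧ pos (π i) a < (w i).2).card := by
      intro a ha
      have := mem_vertices.1 (htv (List.mem_toFinset.2 ha))
      simpa only [mem_substr (hb _).1] using this
    rw [hred]
    refine ⟨?_, ?_⟩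
    · rw [List.nodup_append]
      refine ⟨htn, h1, ?_⟩
      rintro a ha b hb' rfl
      have c1 := htcount a ha
      have c2 := h2 a hb'
      have c3 : (Finset.univ.filter fun i => (w i).2 ≤ pos (π i) a).card ≤
          (Finset.univ.filter fun i =>
            ¬ ((w i).1 ≤ pos (π i) a ∧ pos (π i) a < (w i).2)).card := by
        refine Finset.card_le_card fun i hi => ?_
        simp only [Finset.mem_filter, Finset.mem_univ, true_and] at hi ⊢
        omega
      have c4 := card_filter_add_card_filter_not fun i =>
        (w i).1 ≤ pos (π i) a ∧ pos (π i) a < (w i).2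
      omega
    · intro a ha
      rcases List.mem_append.1 ha with ha | ha
      · refine (htcount a ha).trans (Finset.card_le_card fun i hi => ?_)
        simp only [Finset.mem_filter, Finset.mem_univ, true_and] at hi ⊢
        exact (hvw i).trans hi.1
      · refine (h2 a ha).trans (Finset.card_le_card fun i hi => ?_)
        simp only [Finset.mem_filter, Finset.mem_univ, true_and] at hi ⊢
        exact ((hvw i).trans (hb i).2.1).trans hi

/-- The output belonging to a valid sequence is a permutation, and its total distance to the
inputs is at most the objective value of the sequence. -/
theorem exists_postProcess_induced (hn : 0 < n) {ε : ℝ} (hε : 0 ≤ ε)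
    {π : Fin 5 → Equiv.Perm (Fin n)} {R : ℕ → Group → List (Option (Fin n))}
    (hR : IsCandidates ε π R) {q : List (ℕ × Group)} (hq : IsValid n ε q) :
    ∃ y : Equiv.Perm (Fin n), postProcess (induced ε R q) = str y ∧
      ∑ i, ed (str y) (str (π i)) ≤ blockED ε π R q := by
  have hv := hq.validFrom
  have hlen : n ≤ (induced ε R q).length := by
    have := blocksLength_le_length_inducedFrom hR hv
    rwa [blocksLength, ← Finset.range_eq_Ico, sum_blockSize n (numBlocks_pos hn hε)] at this
  obtain ⟨y, hy, hsub⟩ := exists_postProcess_eq_str (nodup_reduceOption_inducedFrom hR hv).1 hlen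
  refine ⟨y, hy, le_trans (Finset.sum_le_sum fun i _ => ?_)
    (sum_ed_inducedFrom_le π R hv fun _ => le_rfl)⟩
  exact ed_str_le_ed_of_reduceOption_sublist hlen hsub (π i)

/-! ### Existence of cheap valid sequences -/

theorem ValidFrom.mono {ε : ℝ} {q : List (ℕ × Group)} {p p' : ℕ} {v v' : Fin 5 → ℕ}
    (h : ValidFrom n ε p v q) (hp : p' ≤ p) (hv : ∀ i, v' i ≤ v i) : ValidFrom n ε p' v' q := by
  cases q with
  | nil => exact hp.trans h
  | cons a q =>
    obtain ⟨j, w⟩ := a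
    obtain ⟨h1, h2, h3, h4, h5⟩ := h
    exact ⟨hp.trans h1, h2, h3, fun i => (hv i).trans (h4 i), h5⟩

theorem alignCostFrom_le_add (K : ℕ) (π : Fin 5 → Equiv.Perm (Fin n))
    (R : ℕ → Group → List (Option (Fin n))) (p : ℕ) (v v' : Fin 5 → ℕ) (q : List (ℕ × Group)) :
    alignCostFrom K π R p v q ≤ ∑ i, (v' i - v i) + alignCostFrom K π R p v' q := by
  cases q with
  | nil =>
    simp only [alignCostFrom]
    rw [← Finset.sum_add_distrib]
    exact Finset.sum_le_sum fun i _ => by omega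
  | cons a q =>
    obtain ⟨j, w⟩ := a
    simp only [alignCostFrom]
    have h : ∑ i, (blocksLength n K p j + ((w i).1 - v i)) ≤
        ∑ i, (v' i - v i) + ∑ i, (blocksLength n K p j + ((w i).1 - v' i)) := by
      rw [← Finset.sum_add_distrib]
      exact Finset.sum_le_sum fun i _ => by omega
    omega

theorem blocksLength_succ_left (n K : ℕ) {p j : ℕ} (h : p < j) :
    blocksLength n K p j = blockSize n K p + blocksLength n K (p + 1) j :=
  Finset.sum_eq_sum_Ico_succ_bot h _

theorem alignCostFrom_skip {ε : ℝ} (π : Fin 5 → Equiv.Perm (Fin n))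
    (R : ℕ → Group → List (Option (Fin n))) {p : ℕ} {v u : Fin 5 → ℕ} {q : List (ℕ × Group)}
    (hq : ValidFrom n ε (p + 1) u q) :
    alignCostFrom (numBlocks n ε) π R p v q =
      ∑ _i : Fin 5, blockSize n (numBlocks n ε) p + alignCostFrom (numBlocks n ε) π R (p + 1) v q := by
  cases q with
  | nil =>
    simp only [alignCostFrom]
    rw [← Finset.sum_add_distrib, blocksLength_succ_left n _ (Nat.lt_of_succ_le hq)]
    exact Finset.sum_congr rfl fun i _ => by omega
  | cons a q =>
    obtain ⟨j, w⟩ := a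
    obtain ⟨h1, -⟩ := hq
    simp only [alignCostFrom]
    have h : ∑ i, (blocksLength n (numBlocks n ε) p j + ((w i).1 - v i)) =
        ∑ _i : Fin 5, blockSize n (numBlocks n ε) p +
          ∑ i, (blocksLength n (numBlocks n ε) (p + 1) j + ((w i).1 - v i)) := by
      rw [← Finset.sum_add_distrib, blocksLength_succ_left n _ (Nat.lt_of_succ_le h1)]
      exact Finset.sum_congr rfl fun i _ => by omega
    omega

/-- The sequence of all blocks whose windows form a group, with a bound on its cost. -/
theorem exists_validFrom_alignCostFrom_le {ε : ℝ} {π : Fin 5 → Equiv.Perm (Fin n)}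
    {R : ℕ → Group → List (Option (Fin n))} {s e : Fin 5 → ℕ → ℕ} {C : ℕ → ℤ}
    (hsn : ∀ i j, s i j ≤ n + 1)
    (hse : ∀ i, ∀ j < numBlocks n ε, s i j ≤ e i j ∧ e i j ≤ s i (j + 1))
    (hkeep : ∀ j < numBlocks n ε, (fun i => (s i j, e i j)) ∈ groups n ε j →
      ∑ i, ((ed (R j fun i => (s i j, e i j)) ((substr (π i) (s i j, e i j)).map some) : ℤ) +
        (s i (j + 1) - e i j)) ≤ C j)
    (hskip : ∀ j < numBlocks n ε, (fun i => (s i j, e i j)) ∉ groups n ε j →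
      ∑ i, ((blockSize n (numBlocks n ε) j : ℤ) + (s i (j + 1) - s i j)) ≤ C j)
    {p : ℕ} (hp : p ≤ numBlocks n ε) :
    ∃ q, ValidFrom n ε p (fun i => s i p) q ∧
      (q = [] → ∀ j, p ≤ j → j < numBlocks n ε → (fun i => (s i j, e i j)) ∉ groups n ε j) ∧
      (alignCostFrom (numBlocks n ε) π R p (fun i => s i p) q : ℤ) ≤
        ∑ j ∈ Finset.Ico p (numBlocks n ε), C j + ∑ i, ((n : ℤ) + 1 - s i (numBlocks n ε)) := by
  induction hp using Nat.decreasingInduction with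
  | self =>
    refine ⟨[], le_rfl, fun _ j h1 h2 => absurd h1 h2.not_ge, ?_⟩
    simp only [alignCostFrom, blocksLength, Finset.Ico_self, Finset.sum_empty, zero_add]
    push_cast
    refine Finset.sum_le_sum fun i _ => ?_
    have := hsn i (numBlocks n ε)
    omega
  | of_succ p hp ih =>
    obtain ⟨q, hq, hnil, hcost⟩ := ih
    rw [Finset.sum_eq_sum_Ico_succ_bot hp]
    by_cases hw : (fun i => (s i p, e i p)) ∈ groups n ε p
    · refine ⟨(p, fun i => (s i p, e i p)) :: q, ⟨le_rfl, hp, hw, fun i => le_rfl,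
        hq.mono le_rfl fun i => (hse i p hp).2⟩, by simp, ?_⟩
      have h1 := alignCostFrom_le_add (numBlocks n ε) π R (p + 1) (fun i => e i p)
        (fun i => s i (p + 1)) q
      have h2 := hkeep p hp hw
      have h3 : ((∑ i, (s i (p + 1) - e i p) : ℕ) : ℤ) = ∑ i, ((s i (p + 1) : ℤ) - e i p) := by
        push_cast
        exact Finset.sum_congr rfl fun i _ => by have := (hse i p hp).2; omega
      have h4 : (alignCostFrom (numBlocks n ε) π R (p + 1) (fun i => e i p) q : ℤ) ≤
          ∑ i, ((s i (p + 1) : ℤ) - e i p) +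
            alignCostFrom (numBlocks n ε) π R (p + 1) (fun i => s i (p + 1)) q := by
        rw [← h3]
        exact_mod_cast h1
      rw [Finset.sum_add_distrib] at h2
      simp only [alignCostFrom, blocksLength, Finset.Ico_self, Finset.sum_empty, Nat.sub_self,
        add_zero, Finset.sum_const_zero, zero_add]
      push_cast
      linarith
    · refine ⟨q, hq.mono p.le_succ fun i => (hse i p hp).1.trans (hse i p hp).2, ?_, ?_⟩
      · intro h0 j hj hjK
        rcases hj.lt_or_eq with h | rfl
        · exact hnil h0 j h hjK
        · exact hw
      · have h1 := alignCostFrom_le_add (numBlocks n ε) π R (p + 1) (fun i => s i p)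
          (fun i => s i (p + 1)) q
        have h2 := hskip p hp hw
        have h3 : ((∑ i, (s i (p + 1) - s i p) : ℕ) : ℤ) = ∑ i, ((s i (p + 1) : ℤ) - s i p) := by
          push_cast
          exact Finset.sum_congr rfl fun i _ => by have := hse i p hp; omega
        have h4 : (alignCostFrom (numBlocks n ε) π R (p + 1) (fun i => s i p) q : ℤ) ≤
            ∑ i, ((s i (p + 1) : ℤ) - s i p) +
              alignCostFrom (numBlocks n ε) π R (p + 1) (fun i => s i (p + 1)) q := by
          rw [← h3]
          exact_mod_cast h1
        rw [alignCostFrom_skip π R hq]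
        rw [Finset.sum_add_distrib] at h2
        push_cast
        linarith

/-- Selecting only the first block, with windows at its own position, is always possible. -/
theorem exists_isValid_blockED_le (hn : 0 < n) {ε : ℝ} (hε : 0 ≤ ε)
    {π : Fin 5 → Equiv.Perm (Fin n)} {R : ℕ → Group → List (Option (Fin n))}
    (hR : IsCandidates ε π R) : ∃ q, IsValid n ε q ∧ blockED ε π R q ≤ 15 * n := by
  have hK := numBlocks_pos hn hε
  have hsize := sum_blockSize n hK
  rw [Finset.range_eq_Ico, Finset.sum_eq_sum_Ico_succ_bot hK] at hsize
  let w : Group := fun _ => (1, 1 + blockSize n (numBlocks n ε) 0)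
  have hw : w ∈ groups n ε 0 := by
    refine Or.inl fun i => ⟨le_rfl, Nat.le_add_right 1 _, by simp only [w]; omega, 0,
      isScale_zero hn, ⟨?_, ?_, ?_⟩, Or.inl rfl⟩
    · simp [blockStart_zero, w]
    · simp [blockStart_zero, w]
    · rw [gap_zero hn hε]
  obtain ⟨t, htn, -, ht⟩ := (hR 0 hK w hw).exists_list
  have htl : t.length ≤ n := by simpa using htn.length_le_card
  have hlen : (R 0 w).length ≤ n := by
    rw [ht]
    simp only [List.length_append, List.length_map, List.length_replicate]
    omega
  have hed : ∀ i, ed (R 0 w) ((substr (π i) (w i)).map some) ≤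
      n + blockSize n (numBlocks n ε) 0 := by
    intro i
    refine (ed_le_length_add_length _ _).trans ?_
    rw [List.length_map, length_substr (π i) le_rfl (by simp only [w]; omega)]
    have : (w i).2 - (w i).1 = blockSize n (numBlocks n ε) 0 := Nat.add_sub_cancel_left _ _
    omega
  have hsum := Finset.sum_le_sum fun (i : Fin 5) (_ : i ∈ Finset.univ) => hed i
  have hcost : blockED ε π R [(0, w)] = 5 * 0 + ∑ i, ed (R 0 w) ((substr (π i) (w i)).map some) +
      5 * (∑ h ∈ Finset.Ico (0 + 1) (numBlocks n ε), blockSize n (numBlocks n ε) h +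
        (n + 1 - (1 + blockSize n (numBlocks n ε) 0))) := by
    simp only [blockED, alignCostFrom, blocksLength, Finset.Ico_self, Finset.sum_empty, w,
      Finset.sum_const, Finset.card_univ, Fintype.card_fin, smul_eq_mul, Nat.sub_self, add_zero]
  refine ⟨[(0, w)], ⟨by simp, by simpa using ⟨hK, hw⟩, List.isChain_singleton _⟩, ?_⟩
  -- For each string, `n + B₀` for the chosen block, `n - B₀` for dummies and `n - B₀` for uncovered
  -- positions, hence at most `3n`.
  rw [hcost]
  simp only [Finset.sum_const, Finset.card_univ, Fintype.card_fin, smul_eq_mul] at hsum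
  omega

/-- The algorithm has an output. -/
theorem exists_isOutput (hn : 0 < n) {ε : ℝ} (hε : 0 ≤ ε) (π : Fin 5 → Equiv.Perm (Fin n)) :
    ∃ out, IsOutput ε π out := by
  choose R hR using fun (j : ℕ) (w : Group) =>
    exists_isReconstruction (fun i => substr (π i) (w i)) (blockSize n (numBlocks n ε) j)
  have hR' : IsCandidates ε π R := fun j _ w _ => hR j w
  obtain ⟨q, hq, -⟩ := exists_isValid_blockED_le hn hε hR'
  let s : Set (List (ℕ × Group)) := {r | IsValid n ε r}
  refine ⟨_, R, Function.argminOn (blockED ε π R) s ⟨q, hq⟩, hR', ⟨?_, ?_⟩, rfl⟩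
  · exact Function.argminOn_mem _ s _
  · intro r hr
    exact Function.argminOn_le _ s hr

/-- Groups tolerate one degenerate window, so a block is skipped only if two windows are empty; then
all its symbols are unmatched twice. -/
theorem exists_ne_of_not_mem_groups {ε : ℝ} {j : ℕ} {w : Group} (hj : j < numBlocks n ε)
    (h : ∀ i, w i ∈ windows n ε j ∨ (w i).1 = (w i).2 ∧ w i ∈ emptyWindows n ε j)
    (hw : w ∉ groups n ε j) : ∃ i i', i ≠ i' ∧ (w i).1 = (w i).2 ∧ (w i').1 = (w i').2 := by
  have h1 : ¬ ∀ i, w i ∈ windows n ε j := fun h1 => hw (Or.inl h1)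
  push Not at h1
  obtain ⟨i₀, hi₀⟩ := h1
  have hi₀' := (h i₀).resolve_left hi₀
  have h2 : ¬ ∀ i, i ≠ i₀ → w i ∈ windows n ε j := fun h2 =>
    hw (Or.inr ⟨i₀, ⟨j, hj, hi₀'.2⟩, h2⟩)
  push Not at h2
  obtain ⟨i, hne, hi⟩ := h2
  exact ⟨i₀, i, hne.symm, hi₀'.1, ((h i).resolve_left hi).1⟩

/-- A cheap valid sequence, built from windows that contain most symbols of the matching blocks
of `x`. -/
theorem exists_isValid_of_windows (hn : 0 < n) {ε : ℝ} (hε : 0 ≤ ε) {x : Equiv.Perm (Fin n)}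
    {π : Fin 5 → Equiv.Perm (Fin n)} {R : ℕ → Group → List (Option (Fin n))}
    (hR : IsCandidates ε π R) {s e : Fin 5 → ℕ → ℕ} {M : Fin 5 → Finset (Fin n)}
    (hmono : ∀ i, Monotone (s i)) (hs1 : ∀ i j, 1 ≤ s i j) (hsn : ∀ i j, s i j ≤ n + 1)
    (hse : ∀ i, ∀ j < numBlocks n ε, s i j ≤ e i j ∧ e i j ≤ s i (j + 1))
    (hwin : ∀ i, ∀ j < numBlocks n ε, (s i j, e i j) ∈ windows n ε j ∨
      s i j = e i j ∧ (s i j, e i j) ∈ emptyWindows n ε j)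
    (hM : ∀ i, AgreeOn x (π i) (M i))
    (hMw : ∀ i, ∀ a ∈ M i, s i (blockIndex n (numBlocks n ε) (pos x a)) ≤ pos (π i) a ∧
      pos (π i) a < e i (blockIndex n (numBlocks n ε) (pos x a))) :
    ∃ q, IsValid n ε q ∧ (blockED ε π R q : ℤ) ≤
      ∑ i, (2 * (n : ℤ) - 2 * (M i).card) + 30 * (unreliable M).card := by
  have hK := numBlocks_pos hn hε
  set K := numBlocks n ε with hKdef
  let X : ℕ → Finset (Fin n) := fun j => Finset.univ.filter fun a => blockIndex n K (pos x a) = j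
  let S : ℕ → Fin 5 → List (Fin n) := fun j i => substr (π i) (s i j, e i j)
  have hXB : ∀ j < K, (X j).card = blockSize n K j := fun j hj => card_blockIndex_eq hn hK x hj
  have hmemS : ∀ i j a, a ∈ S j i ↔ s i j ≤ pos (π i) a ∧ pos (π i) a < e i j := fun i j a =>
    mem_substr (hs1 i j)
  have hMS : ∀ j i, M i ∩ X j ⊆ (S j i).toFinset := by
    intro j i a ha
    simp only [X, Finset.mem_inter, Finset.mem_filter, Finset.mem_univ, true_and] at ha
    rw [List.mem_toFinset, hmemS, ← ha.2]
    exact hMw i a ha.1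
  have hdisj : ∀ i a j j', j < K → j' < K → a ∈ S j i → a ∈ S j' i → j = j' := by
    have key : ∀ i a j j', j < K → a ∈ S j i → a ∈ S j' i → ¬ j < j' := by
      intro i a j j' hj h h' hlt
      rw [hmemS] at h h'
      have h1 := (hse i j hj).2
      have h2 : s i (j + 1) ≤ s i j' := hmono i hlt
      omega
    intro i a j j' hj hj' h h'
    exact le_antisymm (not_lt.1 (key i a j' j hj' h' h)) (not_lt.1 (key i a j j' hj h h'))
  have hblk : ∀ a, blockIndex n K (pos x a) < K := fun a =>
    blockIndex_lt hn hK (one_le_pos x a) (pos_lt x a)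
  -- A foreign symbol in a window of block `j` is unmatched there, since a matched one lies in the
  -- disjoint window of its own block; a vertex occurs in four windows.
  have hVX : ∀ j < K, vertices (S j) \ X j ⊆ unreliable M := by
    intro j hj a ha
    simp only [X, Finset.mem_sdiff, mem_vertices, Finset.mem_filter, Finset.mem_univ,
      true_and] at ha
    rw [mem_unreliable]
    refine (by omega : 2 ≤ 4).trans (ha.1.trans (Finset.card_le_card fun i hi => ?_))
    simp only [Finset.mem_filter, Finset.mem_univ, true_and] at hi ⊢
    intro haM
    exact ha.2 (hdisj i a _ j (hblk a) hj ((hmemS i _ a).2 (hMw i a haM)) hi)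
  have hskipX : ∀ j < K, (fun i => (s i j, e i j)) ∉ groups n ε j → X j ⊆ unreliable M := by
    intro j hj hw a ha
    obtain ⟨i, i', hne, h1, h2⟩ := exists_ne_of_not_mem_groups hj (fun i => hwin i j hj) hw
    simp only [X, Finset.mem_filter, Finset.mem_univ, true_and] at ha
    rw [mem_unreliable]
    have hnot : ∀ i, s i j = e i j → a ∉ M i := by
      intro i h haM
      have := hMw i a haM
      rw [ha] at this
      omega
    refine Finset.one_lt_card.2 ⟨i, ?_, i', ?_, hne⟩
    · simpa using hnot i h1
    · simpa using hnot i' h2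
  -- One bound for both cases. For a skipped block, `X j` is entirely unreliable, so the second
  -- summand cancels `2|M i ∩ X j|`.
  let C : ℕ → ℤ := fun j =>
    ∑ i, ((blockSize n K j : ℤ) + (s i (j + 1) - s i j) - 2 * (M i ∩ X j).card) +
      5 * (2 * (X j ∩ unreliable M).card + 4 * (vertices (S j) ∩ unreliable M).card)
  have hconst : ∀ c : ℤ, ∑ _i : Fin 5, c = 5 * c := fun c => by simp
  obtain ⟨q, hq, hnil, hcost⟩ := exists_validFrom_alignCostFrom_le (R := R) (π := π) (C := C)
    hsn hse (by
      intro j hj hw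
      simp only [C]
      rw [← hconst, ← Finset.sum_add_distrib]
      refine Finset.sum_le_sum fun i _ => ?_
      have h1 := hR j hj _ hw
      rw [← hKdef, ← hXB j hj] at h1
      have h2 := h1.ed_add_le (p := π) (fun i => pairwise_substr (π i) _) hM (hMS j) (hVX j hj) i
      have h3 := length_substr (π i) (w := (s i j, e i j)) (hs1 i j)
        ((hse i j hj).2.trans (hsn i _))
      have h4 := (hse i j hj).1
      simp only at h2 h3
      rw [h3, hXB j hj] at h2
      simp only [S]
      omega) (by
      intro j hj hw
      simp only [C]
      rw [← hconst, ← Finset.sum_add_distrib]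
      refine Finset.sum_le_sum fun i _ => ?_
      have h1 := Finset.card_le_card (Finset.inter_subset_right (s₁ := M i) (s₂ := X j))
      rw [Finset.inter_eq_left.2 (hskipX j hj hw), ← hKdef, ← hXB j hj]
      omega) (Nat.zero_le K)
  by_cases hq0 : q = []
  · -- every symbol is unreliable, so that any valid sequence is cheap enough
    have huniv : unreliable M = Finset.univ := by
      refine Finset.eq_univ_of_forall fun a => ?_
      exact hskipX _ (hblk a) (hnil hq0 _ (Nat.zero_le _) (hblk a)) (by simp [X])
    obtain ⟨r, hr, hrc⟩ := exists_isValid_blockED_le hn hε hR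
    refine ⟨r, hr, ?_⟩
    have h1 : 0 ≤ ∑ i, (2 * (n : ℤ) - 2 * (M i).card) := Finset.sum_nonneg fun i _ => by
      have : (M i).card ≤ n := by simpa using (M i).card_le_univ
      omega
    rw [huniv, Finset.card_univ, Fintype.card_fin]
    omega
  refine ⟨q, (hq.mono le_rfl fun i => hs1 i 0 : ValidFrom n ε 0 (fun _ => 1) q).isValid hq0, ?_⟩
  have h1 : (blockED ε π R q : ℤ) ≤
      ∑ i, ((s i 0 : ℤ) - 1) + alignCostFrom K π R 0 (fun i => s i 0) q := by
    have h2 : ((∑ i, (s i 0 - 1) : ℕ) : ℤ) = ∑ i, ((s i 0 : ℤ) - 1) := by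
      push_cast
      exact Finset.sum_congr rfl fun i _ => by have := hs1 i 0; omega
    rw [← h2]
    exact_mod_cast alignCostFrom_le_add K π R 0 (fun _ => 1) (fun i => s i 0) q
  -- Vertex sets of different blocks are disjoint, again because `4 + 4 > 5`. Each unreliable symbol
  -- therefore costs at most `5 * (2 + 4) = 30`.
  have hunion : ∑ j ∈ Finset.range K, (vertices (S j) ∩ unreliable M).card ≤
      (unreliable M).card := by
    rw [← Finset.card_biUnion]
    · exact Finset.card_le_card (Finset.biUnion_subset.2 fun j _ => Finset.inter_subset_right)
    · intro j hj j' hj' hne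
      rw [Function.onFun, Finset.disjoint_left]
      intro a ha ha'
      have c1 := mem_vertices.1 (Finset.mem_inter.1 ha).1
      have c2 := mem_vertices.1 (Finset.mem_inter.1 ha').1
      have c3 := card_filter_add_card_filter_not fun i => a ∈ S j i
      have c4 : (Finset.univ.filter fun i => a ∈ S j' i).card ≤
          (Finset.univ.filter fun i => a ∉ S j i).card := by
        refine Finset.card_le_card fun i hi => ?_
        simp only [Finset.mem_filter, Finset.mem_univ, true_and] at hi ⊢
        exact fun h => hne (hdisj i a j j' (by simpa using hj) (by simpa using hj') h hi)
      omega
  have hfib : ∀ T : Finset (Fin n), ∑ j ∈ Finset.range K, ((T ∩ X j).card : ℤ) = T.card := by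
    intro T
    rw [card_filter_eq_sum_blockIndex hn hK x T]
    push_cast
    refine Finset.sum_congr rfl fun j _ => ?_
    congr 2
    ext a
    simp [X]
  have hsize : ∑ j ∈ Finset.range K, (blockSize n K j : ℤ) = n := by
    exact_mod_cast sum_blockSize n hK
  have hC : ∑ j ∈ Finset.range K, C j =
      ∑ i, ((n : ℤ) + (s i K - s i 0) - 2 * (M i).card) + 5 * (2 * (unreliable M).card +
        4 * ∑ j ∈ Finset.range K, ((vertices (S j) ∩ unreliable M).card : ℤ)) := by
    simp only [C]
    rw [Finset.sum_add_distrib, Finset.sum_comm, ← Finset.mul_sum, Finset.sum_add_distrib,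
      ← Finset.mul_sum, ← Finset.mul_sum]
    congr 1
    · refine Finset.sum_congr rfl fun i _ => ?_
      rw [Finset.sum_sub_distrib, Finset.sum_add_distrib, ← Finset.mul_sum, hfib, hsize,
        Finset.sum_range_sub (fun j => (s i j : ℤ))]
    · simp only [Finset.inter_comm (X _), hfib]
  rw [← Finset.range_eq_Ico, hC] at hcost
  have h3 : ∑ i, ((s i 0 : ℤ) - 1) + (∑ i, ((n : ℤ) + (s i K - s i 0) - 2 * (M i).card) +
      ∑ i, ((n : ℤ) + 1 - s i K)) = ∑ i, (2 * (n : ℤ) - 2 * (M i).card) := by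
    rw [← Finset.sum_add_distrib, ← Finset.sum_add_distrib]
    exact Finset.sum_congr rfl fun i _ => by ring
  have h4 : ∑ j ∈ Finset.range K, ((vertices (S j) ∩ unreliable M).card : ℤ) ≤
      (unreliable M).card := by exact_mod_cast hunion
  linarith

/-- Some valid sequence costs little more than the total distance of `x` to the inputs. -/
theorem exists_isValid_blockED_le_sum_ed (hn : 0 < n) {ε : ℝ} (hε : 0 ≤ ε)
    (x : Equiv.Perm (Fin n)) {π : Fin 5 → Equiv.Perm (Fin n)}
    {R : ℕ → Group → List (Option (Fin n))} (hR : IsCandidates ε π R) :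
    ∃ q, IsValid n ε q ∧ (blockED ε π R q : ℝ) ≤ ∑ i, (ed (str x) (str (π i)) : ℝ) +
      (15 * totalSlack π x + 224 * rho * ∑ i, (ed (str x) (str (π i)) : ℝ)) := by
  choose A hA hAc using fun i => exists_agreeOn x (π i)
  choose s e hmono hs1 hsn hse hwin hlost using fun i => exists_windows hn hε (hA i)
  let M : Fin 5 → Finset (Fin n) := fun i => (A i).filter fun a =>
    s i (blockIndex n (numBlocks n ε) (pos x a)) ≤ pos (π i) a ∧
      pos (π i) a < e i (blockIndex n (numBlocks n ε) (pos x a))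
  have hMA : ∀ i, M i ⊆ A i := fun i => Finset.filter_subset _ _
  obtain ⟨q, hq, hcost⟩ := exists_isValid_of_windows hn hε hR (M := M) hmono hs1 hsn hse hwin
    (fun i a ha b hb => hA i a (hMA i ha) b (hMA i hb))
    (fun i a ha => (Finset.mem_filter.1 ha).2)
  refine ⟨q, hq, ?_⟩
  have hsplit : ∀ i, (A i \ M i).card + (M i).card = (A i).card := fun i =>
    Finset.card_sdiff_add_card_eq_card (hMA i)
  have hlost' : ∀ i, ((A i \ M i).card : ℝ) ≤ 7 * rho * ed (str x) (str (π i)) := by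
    intro i
    have h1 : A i \ M i = (A i).filter fun a =>
        ¬ (s i (blockIndex n (numBlocks n ε) (pos x a)) ≤ pos (π i) a ∧
          pos (π i) a < e i (blockIndex n (numBlocks n ε) (pos x a))) := by
      simp only [M, Finset.filter_not]
    have h2 : (ed (str x) (str (π i)) : ℝ) + 2 * (A i).card = 2 * n := by exact_mod_cast hAc i
    rw [h1, show (ed (str x) (str (π i)) : ℝ) = 2 * (n - (A i).card) by linarith]
    exact hlost i
  -- A newly unreliable symbol was lost by some window.
  have hbad : (unreliable M).card ≤ (unreliable A).card + ∑ i, (A i \ M i).card := by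
    refine le_trans ?_ (Nat.add_le_add_left Finset.card_biUnion_le _)
    refine (Finset.card_le_card fun a ha => ?_).trans (Finset.card_union_le _ _)
    rw [Finset.mem_union, or_iff_not_imp_left]
    intro ha'
    rw [mem_unreliable] at ha ha'
    by_contra hcon
    simp only [Finset.mem_biUnion, Finset.mem_univ, true_and, Finset.mem_sdiff, not_exists,
      not_and, not_not] at hcon
    refine ha' (ha.trans (Finset.card_le_card fun i hi => ?_))
    simp only [Finset.mem_filter, Finset.mem_univ, true_and] at hi ⊢
    exact fun h => hi (hcon i h)
  have hbad' : ((unreliable M).card : ℝ) ≤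
      (unreliable A).card + ∑ i, ((A i \ M i).card : ℝ) := by exact_mod_cast hbad
  have hslack := two_mul_card_unreliable_le_totalSlack hA hAc
  have hsum : ∑ i, ((A i \ M i).card : ℝ) ≤ 7 * rho * ∑ i, (ed (str x) (str (π i)) : ℝ) := by
    rw [Finset.mul_sum]
    exact Finset.sum_le_sum fun i _ => hlost' i
  have hmain : ∑ i, (2 * (n : ℝ) - 2 * (M i).card) =
      ∑ i, (ed (str x) (str (π i)) : ℝ) + 2 * ∑ i, ((A i \ M i).card : ℝ) := by
    rw [Finset.mul_sum, ← Finset.sum_add_distrib]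
    refine Finset.sum_congr rfl fun i _ => ?_
    have h1 : ((A i \ M i).card : ℝ) + (M i).card = (A i).card := by exact_mod_cast hsplit i
    have h2 : (ed (str x) (str (π i)) : ℝ) + 2 * (A i).card = 2 * n := by exact_mod_cast hAc i
    linarith
  have hcost' : (blockED ε π R q : ℝ) ≤
      ∑ i, (2 * (n : ℝ) - 2 * (M i).card) + 30 * (unreliable M).card := by exact_mod_cast hcost
  -- Lost symbols cost 2 each as mismatches and 30 as unreliable ones, so `(2 + 30) * 7ρ = 224ρ`;
  -- the unreliable symbols of `A` contribute `30 * Δ / 2 = 15Δ`.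
  linarith

end UlamMedian

/-! ### The main theorem -/

theorem mainTheorem6 (n : ℕ) (hn : 0 < n) (ε : ℝ) (hε0 : 0 < ε) (hε1 : ε < 1)
    (P : Finset (Equiv.Perm (Fin n))) (xstar : Equiv.Perm (Fin n))
    (hxstar : UlamMedian.IsMedian P xstar)
    (π : Fin 5 → Equiv.Perm (Fin n)) (hπ : ∀ i, π i ∈ P) :
    (∃ out, UlamMedian.IsOutput ε π out) ∧
    ∀ out, UlamMedian.IsOutput ε π out →
      ∃ y : Equiv.Perm (Fin n), out = UlamMedian.str y ∧
        (UlamMedian.ed (UlamMedian.str y) (UlamMedian.str xstar) : ℝ) ≤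
          0.0009 * ∑ i, (UlamMedian.ed (UlamMedian.str xstar) (UlamMedian.str (π i)) : ℝ) +
          266 * UlamMedian.totalSlack π xstar := by
  refine ⟨UlamMedian.exists_isOutput hn hε0.le π, ?_⟩
  rintro out ⟨R, q, hR, ⟨hq, hopt⟩, rfl⟩
  obtain ⟨y, hy, hcost⟩ := UlamMedian.exists_postProcess_induced hn hε0.le hR hq
  refine ⟨y, hy, ?_⟩
  obtain ⟨r, hr, hrc⟩ := UlamMedian.exists_isValid_blockED_le_sum_ed hn hε0.le xstar hR
  have h1 : (∑ i, (UlamMedian.ed (UlamMedian.str y) (UlamMedian.str (π i)) : ℝ)) ≤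
      UlamMedian.blockED ε π R r := by
    exact_mod_cast hcost.trans (hopt r hr)
  have h2 := UlamMedian.ed_le_of_sum_ed_le (h1.trans hrc)
  -- The bound obtained is `62Δ + 896ρ ∑ ed`; it remains to see that `Δ ≥ 0`, so that 62 may be
  -- raised to 266.
  choose A hA hAc using fun i => UlamMedian.exists_agreeOn xstar (π i)
  have h3 := UlamMedian.two_mul_card_unreliable_le_totalSlack hA hAc
  have h4 : (0 : ℝ) ≤ (UlamMedian.unreliable A).card := Nat.cast_nonneg _
  have h5 : 0 ≤ ∑ i, (UlamMedian.ed (UlamMedian.str xstar) (UlamMedian.str (π i)) : ℝ) :=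
    Finset.sum_nonneg fun i _ => Nat.cast_nonneg _
  have hrho : UlamMedian.rho = 0.000001 := rfl
  rw [hrho] at h2
  linarith
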